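/- **Conventions.** Composition is in diagrammatic order, and naturality of all structural families is understood. *Linearly distributive categories.* A linearly distributive category (LDC) is a category with two monoidal structures $(\otimes,\top)$ and $(\oplus,\bot)$ and natural linear distributivities $\delta^R\colon (A\oplus B)\otimes C\to A\oplus(B\otimes C)$ and $\delta^L\colon A\otimes(B\oplus C)\to (A\otimes B)\oplus C$ satisfying the standard (Cockett–Seely) coherence laws with the units and associators and with each other. It is symmetric (SLDC) if both monoidal structures are symmetric and $\delta^R$ is obtained from $\delta^L$ by conjugation with the braidings. A cartesian linearly distributive category (CLDC) is an SLDC $(\mathbb X,\times,\mathbf 1,+,\mathbf 0)$ whose tensor is the categorical product with terminal unit and whose par is the categorical coproduct with initial unit. Write $t_A\colon A\to\mathbf 1$, $b_A\colon\mathbf 0\to A$, $\pi_i$, $\iota_i$ for the canonical maps. *Linear functors.* A linear functor $F=(F_\otimes,F_\oplus)$ between LDCs consists of a $\otimes$-monoidal functor $(F_\otimes,m_\top,m_\otimes)$, a $\oplus$-comonoidal functor $(F_\oplus,n_\bot,n_\oplus)$ and natural linear strengths $$\nu^R_\otimes\colon F_\otimes(A\oplus B)\to F_\oplus A\oplus F_\otimes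 B,\qquad \nu^L_\otimes\colon F_\otimes(A\oplus B)\to F_\otimes A\oplus F_\oplus B,$$ $$\nu^R_\oplus\colon F_\otimes A\otimes F_\oplus B\to F_\oplus(A\otimes B),\qquad \nu^L_\oplus\colon F_\oplus A\otimes F_\otimes B\to F_\oplus(A\otimes B),$$ satisfying the standard coherence laws. Between SLDCs it is strong symmetric if $m_\top,m_\otimes,n_\bot,n_\oplus$ are isomorphisms, both functors preserve the braidings, and the left strengths are the braided versions of the right ones. A cartesian linear functor is a strong symmetric linear functor between CLDCs. A linear transformation $\alpha\colon F\Rightarrow G$ is a pair of a monoidal transformation $\alpha_\otimes\colon F_\otimes\Rightarrow G_\otimes$ and a comonoidal transformation $\alpha_\oplus\colon G_\oplus\Rightarrow F_\oplus$ compatible with all the linear strengths. *Medial structures.* A symmetric medial linearly distributive category (SMLDC) is an SLDC with maps $\Delta_\bot\colon\bot\to\bot\otimes\bot$, $\nabla_\top\colon\top\oplus\top\to\top$, $m\colon\bot\to\top$ and a natural family $\mu\colon(A\otimes B)\oplus(C\otimes D)\to(A\oplus C)\otimes(B\oplus D)$ such that the category is mix with nullary mix map $m$, $(\bot,\Delta_\bot,m)$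 is a cocommutative $\otimes$-comonoid, $(\top,\nabla_\top,m)$ is a commutative $\oplus$-monoid, the structure is symmetric duoidal (coherence of $\mu,\Delta_\bot,\nabla_\top$ with the associators, unitors and braidings), and $\mu$ is coherent with the linear distributivities: for all $A,B,C,D,Z$, $$(\mu_{A,B,C,D}\otimes 1_Z);\alpha_\otimes;(1\otimes\delta^R_{B,D,Z})=\delta^R_{A\otimes B,C\otimes D,Z};(1\oplus\alpha_\otimes);\mu_{A,B,C,D\otimes Z},$$ $$(\delta^R_{Z,A,B}\oplus 1);\alpha_\oplus;(1_Z\oplus\mu_{A,B,C,D})=\mu_{Z\oplus A,B,C,D};(\alpha_\oplus\otimes 1);\delta^R_{Z,A\oplus C,B\oplus D}$$ ($\alpha_\otimes,\alpha_\oplus$ being the associators), and the two mirror-image equations for $\delta^L$. A strong symmetric medial linear functor between SMLDCs is a strong symmetric linear functor $F$ with maps $m_\bot\colon\bot\to F_\otimes\bot$, $m_\oplus\colon F_\otimes A\oplus F_\otimes B\to F_\otimes(A\oplus B)$ making $F_\otimes$ symmetric monoidal for $(\oplus,\bot)$, and maps $n_\top\colon F_\oplus\top\to\top$, $n_\otimes\colon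 F_\oplus(A\otimes B)\to F_\oplus A\otimes F_\oplus B$ making $F_\oplus$ symmetric comonoidal for $(\otimes,\top)$, such that $F_\otimes$ (with $m_\bot,m_\oplus,m_\top^{-1},m_\otimes^{-1}$) and $F_\oplus$ (with $n_\bot^{-1},n_\oplus^{-1},n_\top,n_\otimes$) are bilax duoidal functors and $$F_\oplus(\Delta_\bot)=n_\bot;\Delta_\bot;(m_\bot\otimes n_\bot^{-1});\nu^R_\oplus,\qquad F_\otimes(\nabla_\top)=\nu^R_\otimes;(n_\top\oplus m_\top^{-1});\nabla_\top;m_\top,$$ $$F_\otimes(\mu);m_\otimes^{-1};(\nu^R_\otimes\otimes\nu^R_\otimes)=\nu^R_\otimes;(n_\otimes\oplus m_\otimes^{-1});\mu,\qquad (\nu^R_\oplus\oplus\nu^R_\oplus);n_\oplus^{-1};F_\oplus(\mu)=\mu;(m_\oplus\otimes n_\oplus^{-1});\nu^R_\oplus,$$ $$m_\oplus;F_\otimes(\alpha_\oplus);\nu^R_\otimes=(\nu^R_\otimes\oplus1);\alpha_\oplus;(1\oplus m_\oplus),\qquad \nu^R_\oplus;F_\oplus(\alpha_\otimes^{-1});n_\otimes=(1\otimes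 n_\otimes);\alpha_\otimes^{-1};(\nu^R_\oplus\otimes1).$$ A medial linear transformation is a linear transformation $(\alpha_\otimes,\alpha_\oplus)$ between such functors for which $\alpha_\otimes$ is also monoidal for $(m_\bot,m_\oplus)$ and $\alpha_\oplus$ is also comonoidal for $(n_\top,n_\otimes)$. Let $\mathbf{CLDC}$ be the (strict) 2-category of CLDCs, cartesian linear functors and linear transformations, and $\mathbf{SMLDC}$ the (strict) 2-category of SMLDCs, strong symmetric medial linear functors and medial linear transformations, both with the usual compositions. **Proposition.** 1. Every CLDC $(\mathbb X,\times,\mathbf 1,+,\mathbf 0)$ is an SMLDC with the canonical structure $\Delta_{\mathbf 0}=b_{\mathbf 0\times\mathbf 0}=\langle 1,1\rangle$, $\nabla_{\mathbf 1}=t_{\mathbf 1+\mathbf 1}=[1,1]$, $m=t_{\mathbf 0}=b_{\mathbf 1}$ and $\mu=\langle\pi_0+\pi_0,\pi_1+\pi_1\rangle=[\iota_0\times\iota_0,\iota_1\times\iota_1]$. 2. Every cartesian linear functor $F$ is a strong symmetric medial linear functor for these structures with $m_{\mathbf 0}=b_{F_\otimes\mathbf 0}$ and $m_+=[F_\otimes\iota_0,F_\otimes\iota_1]$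 on $F_\otimes$, and $n_{\mathbf 1}=t_{F_\oplus\mathbf 1}$ and $n_\times=\langle F_\oplus\pi_0,F_\oplus\pi_1\rangle$ on $F_\oplus$. 3. Every linear transformation between cartesian linear functors is a medial linear transformation for these structures. 4. The resulting inclusion $\mathbf{CLDC}\to\mathbf{SMLDC}$, which equips CLDCs and cartesian linear functors with the structures of 1 and 2 and changes nothing else, is a (strict) 2-functor. -/

import Mathlib

open CategoryTheory CategoryTheory.Limits

universe v₁ v₂ v₃ v u₁ u₂ u₃ u

namespace LinDist

/-! ## Categories with two monoidal structures -/

/-- A category with two monoidal structures, the tensor `(⊗, ⊤)` and the par `(⊕, ⊥)`. -/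
class TwoMonoidal (X : Type u) [Category.{v} X] where
  tensor : MonoidalCategory X
  par : MonoidalCategory X

notation:70 A:71 " ⊠ " B:71 =>
  @MonoidalCategoryStruct.tensorObj _ _ (MonoidalCategory.toMonoidalCategoryStruct (self := TwoMonoidal.tensor)) A B
notation:70 A:71 " ⊞ " B:71 =>
  @MonoidalCategoryStruct.tensorObj _ _ (MonoidalCategory.toMonoidalCategoryStruct (self := TwoMonoidal.par)) A B
notation "⊤ₗ" =>
  @MonoidalCategoryStruct.tensorUnit _ _ (MonoidalCategory.toMonoidalCategoryStruct (self := TwoMonoidal.tensor))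
notation "⊥ₗ" =>
  @MonoidalCategoryStruct.tensorUnit _ _ (MonoidalCategory.toMonoidalCategoryStruct (self := TwoMonoidal.par))
notation:81 f:82 " ⊠ₕ " g:82 =>
  @MonoidalCategoryStruct.tensorHom _ _ (MonoidalCategory.toMonoidalCategoryStruct (self := TwoMonoidal.tensor)) _ _ _ _ f g
notation:81 f:82 " ⊞ₕ " g:82 =>
  @MonoidalCategoryStruct.tensorHom _ _ (MonoidalCategory.toMonoidalCategoryStruct (self := TwoMonoidal.par)) _ _ _ _ f g
notation:81 A:82 " ◁⊠ " f:82 =>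
  @MonoidalCategoryStruct.whiskerLeft _ _ (MonoidalCategory.toMonoidalCategoryStruct (self := TwoMonoidal.tensor)) A _ _ f
notation:81 A:82 " ◁⊞ " f:82 =>
  @MonoidalCategoryStruct.whiskerLeft _ _ (MonoidalCategory.toMonoidalCategoryStruct (self := TwoMonoidal.par)) A _ _ f
notation:81 f:82 " ▷⊠ " A:82 =>
  @MonoidalCategoryStruct.whiskerRight _ _ (MonoidalCategory.toMonoidalCategoryStruct (self := TwoMonoidal.tensor)) _ _ f A
notation:81 f:82 " ▷⊞ " A:82 =>
  @MonoidalCategoryStruct.whiskerRight _ _ (MonoidalCategory.toMonoidalCategoryStruct (self := TwoMonoidal.par)) _ _ f A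
notation "α⊠" =>
  @MonoidalCategoryStruct.associator _ _ (MonoidalCategory.toMonoidalCategoryStruct (self := TwoMonoidal.tensor))
notation "α⊞" =>
  @MonoidalCategoryStruct.associator _ _ (MonoidalCategory.toMonoidalCategoryStruct (self := TwoMonoidal.par))
notation "λ⊠" =>
  @MonoidalCategoryStruct.leftUnitor _ _ (MonoidalCategory.toMonoidalCategoryStruct (self := TwoMonoidal.tensor))
notation "λ⊞" =>
  @MonoidalCategoryStruct.leftUnitor _ _ (MonoidalCategory.toMonoidalCategoryStruct (self := TwoMonoidal.par))
notation "ρ⊠" =>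
  @MonoidalCategoryStruct.rightUnitor _ _ (MonoidalCategory.toMonoidalCategoryStruct (self := TwoMonoidal.tensor))
notation "ρ⊞" =>
  @MonoidalCategoryStruct.rightUnitor _ _ (MonoidalCategory.toMonoidalCategoryStruct (self := TwoMonoidal.par))

/-! ## Linearly distributive categories -/

/-- A linearly distributive category. Mathlib's associators and unitors are isomorphisms
`(A ⊗ B) ⊗ C ≅ A ⊗ (B ⊗ C)`, `⊤ ⊗ A ≅ A` and `A ⊗ ⊤ ≅ A`, for both monoidal structures. -/
class LinDistCategory (X : Type u) [Category.{v} X] extends TwoMonoidal X where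
  δR (A B C : X) : (A ⊞ B) ⊠ C ⟶ A ⊞ (B ⊠ C)
  δL (A B C : X) : A ⊠ (B ⊞ C) ⟶ (A ⊠ B) ⊞ C
  δR_natural {A A' B B' C C' : X} (f : A ⟶ A') (g : B ⟶ B') (h : C ⟶ C') :
    ((f ⊞ₕ g) ⊠ₕ h) ≫ δR A' B' C' = δR A B C ≫ (f ⊞ₕ (g ⊠ₕ h))
  δL_natural {A A' B B' C C' : X} (f : A ⟶ A') (g : B ⟶ B') (h : C ⟶ C') :
    (f ⊠ₕ (g ⊞ₕ h)) ≫ δL A' B' C' = δL A B C ≫ ((f ⊠ₕ g) ⊞ₕ h)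
  -- units and linear distributivities
  leftUnit_δL (A B : X) : (λ⊠ (A ⊞ B)).inv ≫ δL ⊤ₗ A B = (λ⊠ A).inv ▷⊞ B
  rightUnit_δR (A B : X) : (ρ⊠ (A ⊞ B)).inv ≫ δR A B ⊤ₗ = A ◁⊞ (ρ⊠ B).inv
  δR_leftUnit (A B : X) : δR ⊥ₗ A B ≫ (λ⊞ (A ⊠ B)).hom = (λ⊞ A).hom ▷⊠ B
  δL_rightUnit (A B : X) : δL A B ⊥ₗ ≫ (ρ⊞ (A ⊠ B)).hom = A ◁⊠ (ρ⊞ B).hom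
  -- associativities and linear distributivities
  δL_tensor_assoc (A B C D : X) :
    δL (A ⊠ B) C D ≫ ((α⊠ A B C).hom ▷⊞ D) =
      (α⊠ A B (C ⊞ D)).hom ≫ (A ◁⊠ δL B C D) ≫ δL A (B ⊠ C) D
  δR_tensor_assoc (A B C D : X) :
    (α⊠ (A ⊞ B) C D).hom ≫ δR A B (C ⊠ D) =
      (δR A B C ▷⊠ D) ≫ δR A (B ⊠ C) D ≫ (A ◁⊞ (α⊠ B C D).hom)
  δL_par_assoc (A B C D : X) :
    δL A B (C ⊞ D) ≫ (α⊞ (A ⊠ B) C D).inv =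
      (A ◁⊠ (α⊞ B C D).inv) ≫ δL A (B ⊞ C) D ≫ (δL A B C ▷⊞ D)
  δR_par_assoc (A B C D : X) :
    ((α⊞ A B C).inv ▷⊠ D) ≫ δR (A ⊞ B) C D =
      δR A (B ⊞ C) D ≫ (A ◁⊞ δR B C D) ≫ (α⊞ A B (C ⊠ D)).inv
  -- left and right linear distributivities
  δL_δR_par (A B C D : X) :
    δL (A ⊞ B) C D ≫ (δR A B C ▷⊞ D) =
      δR A B (C ⊞ D) ≫ (A ◁⊞ δL B C D) ≫ (α⊞ A (B ⊠ C) D).inv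
  δL_δR_tensor (A B C D : X) :
    (δL A B C ▷⊠ D) ≫ δR (A ⊠ B) C D =
      (α⊠ A (B ⊞ C) D).hom ≫ (A ◁⊠ δR B C D) ≫ δL A B (C ⊠ D)

open LinDistCategory

/-- A symmetric linearly distributive category. -/
class SymmLinDistCategory (X : Type u) [Category.{v} X] extends LinDistCategory X where
  tensorSymm : @SymmetricCategory X _ TwoMonoidal.tensor
  parSymm : @SymmetricCategory X _ TwoMonoidal.par
  δR_braiding (A B C : X) :
    δR A B C = (tensorSymm.toBraidedCategory.braiding (A ⊞ B) C).hom ≫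
      (C ◁⊠ (parSymm.toBraidedCategory.braiding A B).hom) ≫ δL C B A ≫
      ((tensorSymm.toBraidedCategory.braiding C B).hom ▷⊞ A) ≫
      (parSymm.toBraidedCategory.braiding (B ⊠ C) A).hom

notation "β⊠" => @BraidedCategory.braiding _ _ TwoMonoidal.tensor
  (@SymmetricCategory.toBraidedCategory _ _ TwoMonoidal.tensor SymmLinDistCategory.tensorSymm)
notation "β⊞" => @BraidedCategory.braiding _ _ TwoMonoidal.par
  (@SymmetricCategory.toBraidedCategory _ _ TwoMonoidal.par SymmLinDistCategory.parSymm)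

/-! ## Cartesian linearly distributive categories -/

/-- The tensor of a symmetric linearly distributive category is cartesian and its par is
cocartesian: `⊤` is terminal, `⊥` is initial, and the canonical maps
`A ≅ A ⊗ ⊤ ← A ⊗ B → ⊤ ⊗ B ≅ B` and `A ≅ A ⊕ ⊥ → A ⊕ B ← ⊥ ⊕ B ≅ B` form product and
coproduct diagrams. The structural isomorphisms are then the ones of the (co)cartesian structure;
this is the form of Mathlib's `CartesianMonoidalCategory`. -/
class CartesianStructure (X : Type u) [Category.{v} X] [SymmLinDistCategory X] where
  topTerminal : IsTerminal (⊤ₗ : X)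
  botInitial : IsInitial (⊥ₗ : X)
  isProduct (A B : X) : IsLimit (BinaryFan.mk
    ((A ◁⊠ topTerminal.from B) ≫ (ρ⊠ A).hom) ((topTerminal.from A ▷⊠ B) ≫ (λ⊠ B).hom))
  isCoproduct (A B : X) : IsColimit (BinaryCofan.mk
    ((ρ⊞ A).inv ≫ (A ◁⊞ botInitial.to B)) ((λ⊞ B).inv ≫ (botInitial.to A ▷⊞ B)))

section Cartesian

variable {X : Type u} [Category.{v} X] [SymmLinDistCategory X] [CartesianStructure X]

open CartesianStructure

/-- The map `t_A : A ⟶ ⊤`. -/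
def toTop (A : X) : A ⟶ ⊤ₗ := topTerminal.from A

/-- The map `b_A : ⊥ ⟶ A`. -/
def fromBot (A : X) : ⊥ₗ ⟶ A := botInitial.to A

/-- The first product projection. -/
def prodFst (A B : X) : A ⊠ B ⟶ A := (A ◁⊠ toTop B) ≫ (ρ⊠ A).hom

/-- The second product projection. -/
def prodSnd (A B : X) : A ⊠ B ⟶ B := (toTop A ▷⊠ B) ≫ (λ⊠ B).hom

/-- The first coproduct injection. -/
def coprodInl (A B : X) : A ⟶ A ⊞ B := (ρ⊞ A).inv ≫ (A ◁⊞ fromBot B)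

/-- The second coproduct injection. -/
def coprodInr (A B : X) : B ⟶ A ⊞ B := (λ⊞ B).inv ≫ (fromBot A ▷⊞ B)

end Cartesian

/-! ## Symmetric medial linearly distributive categories -/

/-- The additional structure that makes a symmetric linearly distributive category a symmetric
medial linearly distributive category. -/
class MedialStructure (X : Type u) [Category.{v} X] [SymmLinDistCategory X] where
  /-- `⊥`-contraction -/
  Δbot : (⊥ₗ : X) ⟶ ⊥ₗ ⊠ ⊥ₗ
  /-- `⊤`-cocontraction -/
  nablaTop : (⊤ₗ : X) ⊞ ⊤ₗ ⟶ ⊤ₗ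
  /-- nullary mix -/
  mix : (⊥ₗ : X) ⟶ ⊤ₗ
  /-- the medial maps -/
  med (A B C D : X) : (A ⊠ B) ⊞ (C ⊠ D) ⟶ (A ⊞ C) ⊠ (B ⊞ D)
  med_natural {A A' B B' C C' D D' : X} (f : A ⟶ A') (g : B ⟶ B') (h : C ⟶ C') (k : D ⟶ D') :
    ((f ⊠ₕ g) ⊞ₕ (h ⊠ₕ k)) ≫ med A' B' C' D' = med A B C D ≫ ((f ⊞ₕ h) ⊠ₕ (g ⊞ₕ k))
  -- the category is mix with nullary mix map `mix`
  mix_law (A B : X) :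
    (A ◁⊠ (λ⊞ B).inv) ≫ (A ◁⊠ (mix ▷⊞ B)) ≫ δL A ⊤ₗ B ≫ ((ρ⊠ A).hom ▷⊞ B) =
      ((ρ⊞ A).inv ▷⊠ B) ≫ ((A ◁⊞ mix) ▷⊠ B) ≫ δR A ⊤ₗ B ≫ (A ◁⊞ (λ⊠ B).hom)
  -- the medial maps and the linear distributivities
  med_δR_tensor (A B C D Z : X) :
    (med A B C D ▷⊠ Z) ≫ (α⊠ (A ⊞ C) (B ⊞ D) Z).hom ≫ ((A ⊞ C) ◁⊠ δR B D Z) =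
      δR (A ⊠ B) (C ⊠ D) Z ≫ ((A ⊠ B) ◁⊞ (α⊠ C D Z).hom) ≫ med A B C (D ⊠ Z)
  med_δL_tensor (A B C D Z : X) :
    (Z ◁⊠ med A B C D) ≫ (α⊠ Z (A ⊞ C) (B ⊞ D)).inv ≫ (δL Z A C ▷⊠ (B ⊞ D)) =
      δL Z (A ⊠ B) (C ⊠ D) ≫ ((α⊠ Z A B).inv ▷⊞ (C ⊠ D)) ≫ med (Z ⊠ A) B C D
  med_δR_par (A B C D Z : X) :
    (δR Z A B ▷⊞ (C ⊠ D)) ≫ (α⊞ Z (A ⊠ B) (C ⊠ D)).hom ≫ (Z ◁⊞ med A B C D) =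
      med (Z ⊞ A) B C D ≫ ((α⊞ Z A C).hom ▷⊠ (B ⊞ D)) ≫ δR Z (A ⊞ C) (B ⊞ D)
  med_δL_par (A B C D Z : X) :
    ((A ⊠ B) ◁⊞ δL C D Z) ≫ (α⊞ (A ⊠ B) (C ⊠ D) Z).inv ≫ (med A B C D ▷⊞ Z) =
      med A B C (D ⊞ Z) ≫ ((A ⊞ C) ◁⊠ (α⊞ B D Z).inv) ≫ δL (A ⊞ C) (B ⊞ D) Z
  -- `⊥` is a cocommutative comonoid and `⊤` a commutative monoid
  Δbot_assoc :
    Δbot ≫ (⊥ₗ ◁⊠ Δbot) = Δbot ≫ (Δbot ▷⊠ ⊥ₗ) ≫ (α⊠ ⊥ₗ ⊥ₗ (⊥ₗ : X)).hom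
  Δbot_mix_right : Δbot ≫ (⊥ₗ ◁⊠ mix) = (ρ⊠ (⊥ₗ : X)).inv
  Δbot_mix_left : Δbot ≫ (mix ▷⊠ ⊥ₗ) = (λ⊠ (⊥ₗ : X)).inv
  Δbot_comm : Δbot ≫ (β⊠ ⊥ₗ (⊥ₗ : X)).hom = Δbot
  nablaTop_assoc :
    (⊤ₗ ◁⊞ nablaTop) ≫ nablaTop = (α⊞ ⊤ₗ ⊤ₗ (⊤ₗ : X)).inv ≫ (nablaTop ▷⊞ ⊤ₗ) ≫ nablaTop
  mix_right_nablaTop : (⊤ₗ ◁⊞ mix) ≫ nablaTop = (ρ⊞ (⊤ₗ : X)).hom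
  mix_left_nablaTop : (mix ▷⊞ ⊤ₗ) ≫ nablaTop = (λ⊞ (⊤ₗ : X)).hom
  nablaTop_comm : (β⊞ ⊤ₗ (⊤ₗ : X)).hom ≫ nablaTop = nablaTop
  -- the medial maps and the associators
  med_tensor_assoc (A B C D E F : X) :
    med (A ⊠ B) C (D ⊠ E) F ≫ (med A B D E ▷⊠ (C ⊞ F)) ≫
        (α⊠ (A ⊞ D) (B ⊞ E) (C ⊞ F)).hom =
      ((α⊠ A B C).hom ⊞ₕ (α⊠ D E F).hom) ≫ med A (B ⊠ C) D (E ⊠ F) ≫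
        ((A ⊞ D) ◁⊠ med B C E F)
  med_par_assoc (A B C D E F : X) :
    (α⊞ (A ⊠ B) (C ⊠ D) (E ⊠ F)).inv ≫ (med A B C D ▷⊞ (E ⊠ F)) ≫
        med (A ⊞ C) (B ⊞ D) E F =
      ((A ⊠ B) ◁⊞ med C D E F) ≫ med A B (C ⊞ E) (D ⊞ F) ≫
        ((α⊞ A C E).inv ⊠ₕ (α⊞ B D F).inv)
  -- the medial maps and the unitors
  Δbot_med_left (A B : X) :
    (Δbot ▷⊞ (A ⊠ B)) ≫ med ⊥ₗ ⊥ₗ A B ≫ ((λ⊞ A).hom ⊠ₕ (λ⊞ B).hom) = (λ⊞ (A ⊠ B)).hom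
  Δbot_med_right (A B : X) :
    ((A ⊠ B) ◁⊞ Δbot) ≫ med A B ⊥ₗ ⊥ₗ ≫ ((ρ⊞ A).hom ⊠ₕ (ρ⊞ B).hom) = (ρ⊞ (A ⊠ B)).hom
  med_nablaTop_left (A B : X) :
    ((λ⊠ A).inv ⊞ₕ (λ⊠ B).inv) ≫ med ⊤ₗ A ⊤ₗ B ≫ (nablaTop ▷⊠ (A ⊞ B)) = (λ⊠ (A ⊞ B)).inv
  med_nablaTop_right (A B : X) :
    ((ρ⊠ A).inv ⊞ₕ (ρ⊠ B).inv) ≫ med A ⊤ₗ B ⊤ₗ ≫ ((A ⊞ B) ◁⊠ nablaTop) = (ρ⊠ (A ⊞ B)).inv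
  -- the medial maps and the braidings
  med_tensor_braiding (A B C D : X) :
    med A B C D ≫ (β⊠ (A ⊞ C) (B ⊞ D)).hom =
      ((β⊠ A B).hom ⊞ₕ (β⊠ C D).hom) ≫ med B A D C
  med_par_braiding (A B C D : X) :
    med A B C D ≫ ((β⊞ A C).hom ⊠ₕ (β⊞ B D).hom) =
      (β⊞ (A ⊠ B) (C ⊠ D)).hom ≫ med C D A B

open MedialStructure

/-! ## Linear functors -/

section Functors

variable (X : Type u₁) [Category.{v₁} X] (Y : Type u₂) [Category.{v₂} Y]

/-- A functor which is monoidal for the tensor structures. -/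
abbrev TensorLax {X : Type u₁} [Category.{v₁} X] {Y : Type u₂} [Category.{v₂} Y]
    [TwoMonoidal X] [TwoMonoidal Y] (F : X ⥤ Y) :=
  @Functor.LaxMonoidal X _ TwoMonoidal.tensor Y _ TwoMonoidal.tensor F

/-- A functor which is comonoidal for the tensor structures. -/
abbrev TensorOplax {X : Type u₁} [Category.{v₁} X] {Y : Type u₂} [Category.{v₂} Y]
    [TwoMonoidal X] [TwoMonoidal Y] (F : X ⥤ Y) :=
  @Functor.OplaxMonoidal X _ TwoMonoidal.tensor Y _ TwoMonoidal.tensor F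

/-- A functor which is monoidal for the par structures. -/
abbrev ParLax {X : Type u₁} [Category.{v₁} X] {Y : Type u₂} [Category.{v₂} Y]
    [TwoMonoidal X] [TwoMonoidal Y] (F : X ⥤ Y) :=
  @Functor.LaxMonoidal X _ TwoMonoidal.par Y _ TwoMonoidal.par F

/-- A functor which is comonoidal for the par structures. -/
abbrev ParOplax {X : Type u₁} [Category.{v₁} X] {Y : Type u₂} [Category.{v₂} Y]
    [TwoMonoidal X] [TwoMonoidal Y] (F : X ⥤ Y) :=
  @Functor.OplaxMonoidal X _ TwoMonoidal.par Y _ TwoMonoidal.par F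

/-- The data of a linear functor: a `⊗`-monoidal functor `T = F_⊗`, a `⊕`-comonoidal functor
`P = F_⊕` and the four linear strengths. -/
structure LinearFunctorData [TwoMonoidal X] [TwoMonoidal Y] where
  T : X ⥤ Y
  P : X ⥤ Y
  lax : TensorLax T
  oplax : ParOplax P
  νRT (A B : X) : T.obj (A ⊞ B) ⟶ P.obj A ⊞ T.obj B
  νLT (A B : X) : T.obj (A ⊞ B) ⟶ T.obj A ⊞ P.obj B
  νRP (A B : X) : T.obj A ⊠ P.obj B ⟶ P.obj (A ⊠ B)
  νLP (A B : X) : P.obj A ⊠ T.obj B ⟶ P.obj (A ⊠ B)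

namespace LinearFunctorData

variable {X Y}
variable [TwoMonoidal X] [TwoMonoidal Y] (F : LinearFunctorData X Y)

/-- `m_⊤ : ⊤ ⟶ F_⊗ ⊤` -/
abbrev mTop : ⊤ₗ ⟶ F.T.obj ⊤ₗ :=
  @Functor.LaxMonoidal.ε X _ TwoMonoidal.tensor Y _ TwoMonoidal.tensor F.T F.lax

/-- `m_⊗ : F_⊗ A ⊗ F_⊗ B ⟶ F_⊗ (A ⊗ B)` -/
abbrev mTen (A B : X) : F.T.obj A ⊠ F.T.obj B ⟶ F.T.obj (A ⊠ B) :=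
  @Functor.LaxMonoidal.μ X _ TwoMonoidal.tensor Y _ TwoMonoidal.tensor F.T F.lax A B

/-- `n_⊥ : F_⊕ ⊥ ⟶ ⊥` -/
abbrev nBot : F.P.obj ⊥ₗ ⟶ ⊥ₗ :=
  @Functor.OplaxMonoidal.η X _ TwoMonoidal.par Y _ TwoMonoidal.par F.P F.oplax

/-- `n_⊕ : F_⊕ (A ⊕ B) ⟶ F_⊕ A ⊕ F_⊕ B` -/
abbrev nPar (A B : X) : F.P.obj (A ⊞ B) ⟶ F.P.obj A ⊞ F.P.obj B :=
  @Functor.OplaxMonoidal.δ X _ TwoMonoidal.par Y _ TwoMonoidal.par F.P F.oplax A B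

end LinearFunctorData

/-- A linear functor between linearly distributive categories. -/
structure LinearFunctor [LinDistCategory X] [LinDistCategory Y]
    extends LinearFunctorData X Y where
  νRT_natural {A A' B B' : X} (f : A ⟶ A') (g : B ⟶ B') :
    T.map (f ⊞ₕ g) ≫ νRT A' B' = νRT A B ≫ (P.map f ⊞ₕ T.map g)
  νLT_natural {A A' B B' : X} (f : A ⟶ A') (g : B ⟶ B') :
    T.map (f ⊞ₕ g) ≫ νLT A' B' = νLT A B ≫ (T.map f ⊞ₕ P.map g)
  νRP_natural {A A' B B' : X} (f : A ⟶ A') (g : B ⟶ B') :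
    (T.map f ⊠ₕ P.map g) ≫ νRP A' B' = νRP A B ≫ P.map (f ⊠ₕ g)
  νLP_natural {A A' B B' : X} (f : A ⟶ A') (g : B ⟶ B') :
    (P.map f ⊠ₕ T.map g) ≫ νLP A' B' = νLP A B ≫ P.map (f ⊠ₕ g)
  -- units
  νRT_unit (A : X) :
    νRT ⊥ₗ A ≫ (toLinearFunctorData.nBot ▷⊞ T.obj A) ≫ (λ⊞ (T.obj A)).hom =
      T.map (λ⊞ A).hom
  νLT_unit (A : X) :
    νLT A ⊥ₗ ≫ (T.obj A ◁⊞ toLinearFunctorData.nBot) ≫ (ρ⊞ (T.obj A)).hom =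
      T.map (ρ⊞ A).hom
  νRP_unit (A : X) :
    (λ⊠ (P.obj A)).inv ≫ (toLinearFunctorData.mTop ▷⊠ P.obj A) ≫ νRP ⊤ₗ A =
      P.map (λ⊠ A).inv
  νLP_unit (A : X) :
    (ρ⊠ (P.obj A)).inv ≫ (P.obj A ◁⊠ toLinearFunctorData.mTop) ≫ νLP A ⊤ₗ =
      P.map (ρ⊠ A).inv
  -- associativities
  νRT_assoc (A B C : X) :
    νRT A (B ⊞ C) ≫ (P.obj A ◁⊞ νRT B C) ≫ (α⊞ (P.obj A) (P.obj B) (T.obj C)).inv =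
      T.map (α⊞ A B C).inv ≫ νRT (A ⊞ B) C ≫ (toLinearFunctorData.nPar A B ▷⊞ T.obj C)
  νLT_assoc (A B C : X) :
    νLT A (B ⊞ C) ≫ (T.obj A ◁⊞ toLinearFunctorData.nPar B C) ≫
        (α⊞ (T.obj A) (P.obj B) (P.obj C)).inv =
      T.map (α⊞ A B C).inv ≫ νLT (A ⊞ B) C ≫ (νLT A B ▷⊞ P.obj C)
  νRP_assoc (A B C : X) :
    (α⊠ (T.obj A) (T.obj B) (P.obj C)).hom ≫ (T.obj A ◁⊠ νRP B C) ≫ νRP A (B ⊠ C) =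
      (toLinearFunctorData.mTen A B ▷⊠ P.obj C) ≫ νRP (A ⊠ B) C ≫ P.map (α⊠ A B C).hom
  νLP_assoc (A B C : X) :
    (α⊠ (P.obj A) (T.obj B) (T.obj C)).hom ≫ (P.obj A ◁⊠ toLinearFunctorData.mTen B C) ≫
        νLP A (B ⊠ C) =
      (νLP A B ▷⊠ T.obj C) ≫ νLP (A ⊠ B) C ≫ P.map (α⊠ A B C).hom
  -- linear distributivities
  mTen_δR_νRT (A B C : X) :
    toLinearFunctorData.mTen (A ⊞ B) C ≫ T.map (δR A B C) ≫ νRT A (B ⊠ C) =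
      (νRT A B ▷⊠ T.obj C) ≫ δR (P.obj A) (T.obj B) (T.obj C) ≫
        (P.obj A ◁⊞ toLinearFunctorData.mTen B C)
  mTen_δL_νLT (A B C : X) :
    toLinearFunctorData.mTen A (B ⊞ C) ≫ T.map (δL A B C) ≫ νLT (A ⊠ B) C =
      (T.obj A ◁⊠ νLT B C) ≫ δL (T.obj A) (T.obj B) (P.obj C) ≫
        (toLinearFunctorData.mTen A B ▷⊞ P.obj C)
  νRP_δL_nPar (A B C : X) :
    νRP A (B ⊞ C) ≫ P.map (δL A B C) ≫ toLinearFunctorData.nPar (A ⊠ B) C =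
      (T.obj A ◁⊠ toLinearFunctorData.nPar B C) ≫ δL (T.obj A) (P.obj B) (P.obj C) ≫
        (νRP A B ▷⊞ P.obj C)
  νLP_δR_nPar (A B C : X) :
    νLP (A ⊞ B) C ≫ P.map (δR A B C) ≫ toLinearFunctorData.nPar A (B ⊠ C) =
      (toLinearFunctorData.nPar A B ▷⊠ T.obj C) ≫ δR (P.obj A) (P.obj B) (T.obj C) ≫
        (P.obj A ◁⊞ νLP B C)
  -- the other linear strengths via associators
  νRT_νLT (A B C : X) :
    νRT A (B ⊞ C) ≫ (P.obj A ◁⊞ νLT B C) ≫ (α⊞ (P.obj A) (T.obj B) (P.obj C)).inv =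
      T.map (α⊞ A B C).inv ≫ νLT (A ⊞ B) C ≫ (νRT A B ▷⊞ P.obj C)
  νLP_νRP (A B C : X) :
    (α⊠ (T.obj A) (P.obj B) (T.obj C)).hom ≫ (T.obj A ◁⊠ νLP B C) ≫ νRP A (B ⊠ C) =
      (νRP A B ▷⊠ T.obj C) ≫ νLP (A ⊠ B) C ≫ P.map (α⊠ A B C).hom
  -- the other linear strengths via linear distributivities
  mTen_δL_νRT (A B C : X) :
    toLinearFunctorData.mTen A (B ⊞ C) ≫ T.map (δL A B C) ≫ νRT (A ⊠ B) C =
      (T.obj A ◁⊠ νRT B C) ≫ δL (T.obj A) (P.obj B) (T.obj C) ≫ (νRP A B ▷⊞ T.obj C)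
  mTen_δR_νLT (A B C : X) :
    toLinearFunctorData.mTen (A ⊞ B) C ≫ T.map (δR A B C) ≫ νLT A (B ⊠ C) =
      (νLT A B ▷⊠ T.obj C) ≫ δR (T.obj A) (P.obj B) (T.obj C) ≫ (T.obj A ◁⊞ νLP B C)
  νRP_δR_nPar (A B C : X) :
    νRP (A ⊞ B) C ≫ P.map (δR A B C) ≫ toLinearFunctorData.nPar A (B ⊠ C) =
      (νRT A B ▷⊠ P.obj C) ≫ δR (P.obj A) (T.obj B) (P.obj C) ≫ (P.obj A ◁⊞ νRP B C)
  νLP_δL_nPar (A B C : X) :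
    νLP A (B ⊞ C) ≫ P.map (δL A B C) ≫ toLinearFunctorData.nPar (A ⊠ B) C =
      (P.obj A ◁⊠ νLT B C) ≫ δL (P.obj A) (T.obj B) (P.obj C) ≫ (νLP A B ▷⊞ P.obj C)

/-- A strong symmetric linear functor between symmetric linearly distributive categories.
Between cartesian linearly distributive categories these are the cartesian linear functors. -/
structure StrongSymmLinearFunctor [SymmLinDistCategory X] [SymmLinDistCategory Y]
    extends LinearFunctor X Y where
  -- strength
  isIso_mTop : IsIso toLinearFunctorData.mTop
  isIso_mTen (A B : X) : IsIso (toLinearFunctorData.mTen A B)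
  isIso_nBot : IsIso toLinearFunctorData.nBot
  isIso_nPar (A B : X) : IsIso (toLinearFunctorData.nPar A B)
  -- symmetry
  mTen_braiding (A B : X) :
    toLinearFunctorData.mTen A B ≫ T.map (β⊠ A B).hom =
      (β⊠ (T.obj A) (T.obj B)).hom ≫ toLinearFunctorData.mTen B A
  nPar_braiding (A B : X) :
    toLinearFunctorData.nPar A B ≫ (β⊞ (P.obj A) (P.obj B)).hom =
      P.map (β⊞ A B).hom ≫ toLinearFunctorData.nPar B A
  νRT_braiding (A B : X) :
    νRT A B ≫ (β⊞ (P.obj A) (T.obj B)).hom = T.map (β⊞ A B).hom ≫ νLT B A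
  νRP_braiding (A B : X) :
    νRP A B ≫ P.map (β⊠ A B).hom = (β⊠ (T.obj A) (P.obj B)).hom ≫ νLP B A

attribute [instance] StrongSymmLinearFunctor.isIso_mTop StrongSymmLinearFunctor.isIso_mTen
  StrongSymmLinearFunctor.isIso_nBot StrongSymmLinearFunctor.isIso_nPar

variable {X Y}

/-- The additional structure that makes a strong symmetric linear functor between symmetric medial
linearly distributive categories a strong symmetric medial linear functor, before the
compatibilities. -/
structure MedialFunctorData [SymmLinDistCategory X] [SymmLinDistCategory Y]
    (F : StrongSymmLinearFunctor X Y) where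
  parLax : ParLax F.T
  tenOplax : TensorOplax F.P

namespace MedialFunctorData

variable [SymmLinDistCategory X] [SymmLinDistCategory Y] {F : StrongSymmLinearFunctor X Y}
  (M : MedialFunctorData F)

/-- `m_⊥ : ⊥ ⟶ F_⊗ ⊥` -/
abbrev mBot : ⊥ₗ ⟶ F.T.obj ⊥ₗ :=
  @Functor.LaxMonoidal.ε X _ TwoMonoidal.par Y _ TwoMonoidal.par F.T M.parLax

/-- `m_⊕ : F_⊗ A ⊕ F_⊗ B ⟶ F_⊗ (A ⊕ B)` -/
abbrev mPar (A B : X) : F.T.obj A ⊞ F.T.obj B ⟶ F.T.obj (A ⊞ B) :=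
  @Functor.LaxMonoidal.μ X _ TwoMonoidal.par Y _ TwoMonoidal.par F.T M.parLax A B

/-- `n_⊤ : F_⊕ ⊤ ⟶ ⊤` -/
abbrev nTop : F.P.obj ⊤ₗ ⟶ ⊤ₗ :=
  @Functor.OplaxMonoidal.η X _ TwoMonoidal.tensor Y _ TwoMonoidal.tensor F.P M.tenOplax

/-- `n_⊗ : F_⊕ (A ⊗ B) ⟶ F_⊕ A ⊗ F_⊕ B` -/
abbrev nTen (A B : X) : F.P.obj (A ⊠ B) ⟶ F.P.obj A ⊠ F.P.obj B :=
  @Functor.OplaxMonoidal.δ X _ TwoMonoidal.tensor Y _ TwoMonoidal.tensor F.P M.tenOplax A B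

end MedialFunctorData

/-- The structure that makes a strong symmetric linear functor between symmetric medial linearly
distributive categories a strong symmetric medial linear functor. -/
structure MedialFunctorStructure [SymmLinDistCategory X] [SymmLinDistCategory Y]
    [MedialStructure X] [MedialStructure Y] (F : StrongSymmLinearFunctor X Y)
    extends MedialFunctorData F where
  -- symmetry of the two additional (co)monoidal structures
  mPar_braiding (A B : X) :
    toMedialFunctorData.mPar A B ≫ F.T.map (β⊞ A B).hom =
      (β⊞ (F.T.obj A) (F.T.obj B)).hom ≫ toMedialFunctorData.mPar B A
  nTen_braiding (A B : X) :
    toMedialFunctorData.nTen A B ≫ (β⊠ (F.P.obj A) (F.P.obj B)).hom =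
      F.P.map (β⊠ A B).hom ≫ toMedialFunctorData.nTen B A
  -- `F_⊗` is a bilax duoidal functor
  T_Δbot :
    Δbot ≫ (toMedialFunctorData.mBot ⊠ₕ toMedialFunctorData.mBot) ≫ F.mTen ⊥ₗ ⊥ₗ =
      toMedialFunctorData.mBot ≫ F.T.map Δbot
  T_nablaTop :
    (F.mTop ⊞ₕ F.mTop) ≫ toMedialFunctorData.mPar ⊤ₗ ⊤ₗ ≫ F.T.map nablaTop =
      nablaTop ≫ F.mTop
  T_mix : mix ≫ F.mTop = toMedialFunctorData.mBot ≫ F.T.map mix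
  T_med (A B C D : X) :
    (F.mTen A B ⊞ₕ F.mTen C D) ≫ toMedialFunctorData.mPar (A ⊠ B) (C ⊠ D) ≫
        F.T.map (med A B C D) =
      med (F.T.obj A) (F.T.obj B) (F.T.obj C) (F.T.obj D) ≫
        (toMedialFunctorData.mPar A C ⊠ₕ toMedialFunctorData.mPar B D) ≫
        F.mTen (A ⊞ C) (B ⊞ D)
  -- `F_⊕` is a bilax duoidal functor
  P_Δbot :
    F.P.map Δbot ≫ toMedialFunctorData.nTen ⊥ₗ ⊥ₗ ≫ (F.nBot ⊠ₕ F.nBot) = F.nBot ≫ Δbot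
  P_nablaTop :
    F.nPar ⊤ₗ ⊤ₗ ≫ (toMedialFunctorData.nTop ⊞ₕ toMedialFunctorData.nTop) ≫ nablaTop =
      F.P.map nablaTop ≫ toMedialFunctorData.nTop
  P_mix : F.nBot ≫ mix = F.P.map mix ≫ toMedialFunctorData.nTop
  P_med (A B C D : X) :
    F.P.map (med A B C D) ≫ toMedialFunctorData.nTen (A ⊞ C) (B ⊞ D) ≫
        (F.nPar A C ⊠ₕ F.nPar B D) =
      F.nPar (A ⊠ B) (C ⊠ D) ≫
        (toMedialFunctorData.nTen A B ⊞ₕ toMedialFunctorData.nTen C D) ≫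
        med (F.P.obj A) (F.P.obj B) (F.P.obj C) (F.P.obj D)
  -- the linear strengths, `⊥`-contraction and `⊤`-cocontraction
  νRP_Δbot :
    F.P.map Δbot =
      F.nBot ≫ Δbot ≫ (toMedialFunctorData.mBot ⊠ₕ inv F.nBot) ≫ F.νRP ⊥ₗ ⊥ₗ
  νRT_nablaTop :
    F.T.map nablaTop =
      F.νRT ⊤ₗ ⊤ₗ ≫ (toMedialFunctorData.nTop ⊞ₕ inv F.mTop) ≫ nablaTop ≫ F.mTop
  -- the linear strengths and the medial maps
  νRT_med (A B C D : X) :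
    F.T.map (med A B C D) ≫ inv (F.mTen (A ⊞ C) (B ⊞ D)) ≫ (F.νRT A C ⊠ₕ F.νRT B D) =
      F.νRT (A ⊠ B) (C ⊠ D) ≫ (toMedialFunctorData.nTen A B ⊞ₕ inv (F.mTen C D)) ≫
        med (F.P.obj A) (F.P.obj B) (F.T.obj C) (F.T.obj D)
  νRP_med (A B C D : X) :
    (F.νRP A B ⊞ₕ F.νRP C D) ≫ inv (F.nPar (A ⊠ B) (C ⊠ D)) ≫ F.P.map (med A B C D) =
      med (F.T.obj A) (F.P.obj B) (F.T.obj C) (F.P.obj D) ≫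
        (toMedialFunctorData.mPar A C ⊠ₕ inv (F.nPar B D)) ≫ F.νRP (A ⊞ C) (B ⊞ D)
  -- the linear strengths, `m_⊕` and `n_⊗`
  mPar_νRT (A B C : X) :
    toMedialFunctorData.mPar (A ⊞ B) C ≫ F.T.map (α⊞ A B C).hom ≫ F.νRT A (B ⊞ C) =
      (F.νRT A B ▷⊞ F.T.obj C) ≫ (α⊞ (F.P.obj A) (F.T.obj B) (F.T.obj C)).hom ≫
        (F.P.obj A ◁⊞ toMedialFunctorData.mPar B C)
  νRP_nTen (A B C : X) :
    F.νRP A (B ⊠ C) ≫ F.P.map (α⊠ A B C).inv ≫ toMedialFunctorData.nTen (A ⊠ B) C =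
      (F.T.obj A ◁⊠ toMedialFunctorData.nTen B C) ≫
        (α⊠ (F.T.obj A) (F.P.obj B) (F.P.obj C)).inv ≫ (F.νRP A B ▷⊠ F.P.obj C)

variable (X Y) in
/-- A strong symmetric medial linear functor. -/
structure MedialLinearFunctor [SymmLinDistCategory X] [SymmLinDistCategory Y]
    [MedialStructure X] [MedialStructure Y] extends StrongSymmLinearFunctor X Y where
  medial : MedialFunctorStructure toStrongSymmLinearFunctor

/-! ## Linear transformations -/

/-- A linear transformation `F ⟹ G`: a monoidal transformation `F_⊗ ⟹ G_⊗` and a comonoidal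
transformation `G_⊕ ⟹ F_⊕`, compatible with the linear strengths. -/
@[ext]
structure LinearTransformation [LinDistCategory X] [LinDistCategory Y]
    (F G : LinearFunctor X Y) where
  t : F.T ⟶ G.T
  p : G.P ⟶ F.P
  t_mTop : F.mTop ≫ t.app ⊤ₗ = G.mTop
  t_mTen (A B : X) : F.mTen A B ≫ t.app (A ⊠ B) = (t.app A ⊠ₕ t.app B) ≫ G.mTen A B
  p_nBot : p.app ⊥ₗ ≫ F.nBot = G.nBot
  p_nPar (A B : X) : p.app (A ⊞ B) ≫ F.nPar A B = G.nPar A B ≫ (p.app A ⊞ₕ p.app B)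
  νRT_comm (A B : X) :
    t.app (A ⊞ B) ≫ G.νRT A B ≫ (p.app A ▷⊞ G.T.obj B) =
      F.νRT A B ≫ (F.P.obj A ◁⊞ t.app B)
  νLT_comm (A B : X) :
    t.app (A ⊞ B) ≫ G.νLT A B ≫ (G.T.obj A ◁⊞ p.app B) =
      F.νLT A B ≫ (t.app A ▷⊞ F.P.obj B)
  νLP_comm (A B : X) :
    (G.P.obj A ◁⊠ t.app B) ≫ G.νLP A B ≫ p.app (A ⊠ B) =
      (p.app A ▷⊠ F.T.obj B) ≫ F.νLP A B
  νRP_comm (A B : X) :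
    (t.app A ▷⊠ G.P.obj B) ≫ G.νRP A B ≫ p.app (A ⊠ B) =
      (F.T.obj A ◁⊠ p.app B) ≫ F.νRP A B

/-- The additional conditions on a linear transformation between medial linear functors to be a
medial linear transformation. -/
structure IsMedialTransformation [SymmLinDistCategory X] [SymmLinDistCategory Y]
    {F G : StrongSymmLinearFunctor X Y} (M : MedialFunctorData F) (N : MedialFunctorData G)
    (α : LinearTransformation F.toLinearFunctor G.toLinearFunctor) : Prop where
  t_mBot : M.mBot ≫ α.t.app ⊥ₗ = N.mBot
  t_mPar (A B : X) : M.mPar A B ≫ α.t.app (A ⊞ B) = (α.t.app A ⊞ₕ α.t.app B) ≫ N.mPar A B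
  p_nTop : α.p.app ⊤ₗ ≫ M.nTop = N.nTop
  p_nTen (A B : X) : α.p.app (A ⊠ B) ≫ M.nTen A B = N.nTen A B ≫ (α.p.app A ⊠ₕ α.p.app B)

/-- A (strong) medial linear transformation. -/
@[ext]
structure MedialLinearTransformation [SymmLinDistCategory X] [SymmLinDistCategory Y]
    [MedialStructure X] [MedialStructure Y] (F G : MedialLinearFunctor X Y)
    extends LinearTransformation F.toLinearFunctor G.toLinearFunctor where
  isMedial : IsMedialTransformation F.medial.toMedialFunctorData G.medial.toMedialFunctorData
    toLinearTransformation

end Functors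

section Composition

variable {X : Type u₁} [Category.{v₁} X] {Y : Type u₂} [Category.{v₂} Y]
  {Z : Type u₃} [Category.{v₃} Z]

namespace LinearFunctorData

/-- The identity data. -/
def id (X : Type u₁) [Category.{v₁} X] [TwoMonoidal X] : LinearFunctorData X X where
  T := 𝟭 X
  P := 𝟭 X
  lax := @Functor.LaxMonoidal.id X _ TwoMonoidal.tensor
  oplax := @Functor.OplaxMonoidal.id X _ TwoMonoidal.par
  νRT A B := 𝟙 (A ⊞ B)
  νLT A B := 𝟙 (A ⊞ B)
  νRP A B := 𝟙 (A ⊠ B)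
  νLP A B := 𝟙 (A ⊠ B)

/-- The composite data. -/
def comp [TwoMonoidal X] [TwoMonoidal Y] [TwoMonoidal Z]
    (F : LinearFunctorData X Y) (G : LinearFunctorData Y Z) : LinearFunctorData X Z where
  T := F.T ⋙ G.T
  P := F.P ⋙ G.P
  lax := @Functor.LaxMonoidal.comp X _ TwoMonoidal.tensor Y _ TwoMonoidal.tensor
    Z _ TwoMonoidal.tensor F.T G.T F.lax G.lax
  oplax := @Functor.OplaxMonoidal.comp X _ TwoMonoidal.par Y _ TwoMonoidal.par
    Z _ TwoMonoidal.par F.P G.P F.oplax G.oplax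
  νRT A B := G.T.map (F.νRT A B) ≫ G.νRT (F.P.obj A) (F.T.obj B)
  νLT A B := G.T.map (F.νLT A B) ≫ G.νLT (F.T.obj A) (F.P.obj B)
  νRP A B := G.νRP (F.T.obj A) (F.P.obj B) ≫ G.P.map (F.νRP A B)
  νLP A B := G.νLP (F.P.obj A) (F.T.obj B) ≫ G.P.map (F.νLP A B)

section

variable [TwoMonoidal X]

@[simp] lemma id_T : (id X).T = 𝟭 X := rfl
@[simp] lemma id_P : (id X).P = 𝟭 X := rfl
@[simp] lemma id_mTop : (id X).mTop = 𝟙 _ := rfl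
@[simp] lemma id_mTen (A B : X) : (id X).mTen A B = 𝟙 _ := rfl
@[simp] lemma id_nBot : (id X).nBot = 𝟙 _ := rfl
@[simp] lemma id_nPar (A B : X) : (id X).nPar A B = 𝟙 _ := rfl
@[simp] lemma id_νRT (A B : X) : (id X).νRT A B = 𝟙 _ := rfl
@[simp] lemma id_νLT (A B : X) : (id X).νLT A B = 𝟙 _ := rfl
@[simp] lemma id_νRP (A B : X) : (id X).νRP A B = 𝟙 _ := rfl
@[simp] lemma id_νLP (A B : X) : (id X).νLP A B = 𝟙 _ := rfl

variable [TwoMonoidal Y] [TwoMonoidal Z] (F : LinearFunctorData X Y) (G : LinearFunctorData Y Z)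

@[simp] lemma comp_T : (F.comp G).T = F.T ⋙ G.T := rfl
@[simp] lemma comp_P : (F.comp G).P = F.P ⋙ G.P := rfl
@[simp] lemma comp_mTop : (F.comp G).mTop = G.mTop ≫ G.T.map F.mTop := rfl
@[simp] lemma comp_mTen (A B : X) :
    (F.comp G).mTen A B = G.mTen _ _ ≫ G.T.map (F.mTen A B) := rfl
@[simp] lemma comp_nBot : (F.comp G).nBot = G.P.map F.nBot ≫ G.nBot := rfl
@[simp] lemma comp_nPar (A B : X) :
    (F.comp G).nPar A B = G.P.map (F.nPar A B) ≫ G.nPar _ _ := rfl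
@[simp] lemma comp_νRT (A B : X) :
    (F.comp G).νRT A B = G.T.map (F.νRT A B) ≫ G.νRT _ _ := rfl
@[simp] lemma comp_νLT (A B : X) :
    (F.comp G).νLT A B = G.T.map (F.νLT A B) ≫ G.νLT _ _ := rfl
@[simp] lemma comp_νRP (A B : X) :
    (F.comp G).νRP A B = G.νRP _ _ ≫ G.P.map (F.νRP A B) := rfl
@[simp] lemma comp_νLP (A B : X) :
    (F.comp G).νLP A B = G.νLP _ _ ≫ G.P.map (F.νLP A B) := rfl

end

section

variable [TwoMonoidal X] [TwoMonoidal Y] (F : LinearFunctorData X Y)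

lemma mTen_natural {A A' B B' : X} (f : A ⟶ A') (g : B ⟶ B') :
    (F.T.map f ⊠ₕ F.T.map g) ≫ F.mTen A' B' = F.mTen A B ≫ F.T.map (f ⊠ₕ g) :=
  @Functor.LaxMonoidal.μ_natural X _ TwoMonoidal.tensor Y _ TwoMonoidal.tensor F.T F.lax
    _ _ _ _ f g

lemma nPar_natural {A A' B B' : X} (f : A ⟶ A') (g : B ⟶ B') :
    F.nPar A B ≫ (F.P.map f ⊞ₕ F.P.map g) = F.P.map (f ⊞ₕ g) ≫ F.nPar A' B' :=
  @Functor.OplaxMonoidal.δ_natural X _ TwoMonoidal.par Y _ TwoMonoidal.par F.P F.oplax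
    _ _ _ _ f g

lemma mTen_natural_left {A A' : X} (f : A ⟶ A') (B : X) :
    (F.T.map f ▷⊠ F.T.obj B) ≫ F.mTen A' B = F.mTen A B ≫ F.T.map (f ▷⊠ B) :=
  @Functor.LaxMonoidal.μ_natural_left X _ TwoMonoidal.tensor Y _ TwoMonoidal.tensor F.T F.lax
    _ _ f B

lemma mTen_natural_right (A : X) {B B' : X} (f : B ⟶ B') :
    (F.T.obj A ◁⊠ F.T.map f) ≫ F.mTen A B' = F.mTen A B ≫ F.T.map (A ◁⊠ f) :=
  @Functor.LaxMonoidal.μ_natural_right X _ TwoMonoidal.tensor Y _ TwoMonoidal.tensor F.T F.lax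
    _ _ A f

lemma nPar_natural_left {A A' : X} (f : A ⟶ A') (B : X) :
    F.nPar A B ≫ (F.P.map f ▷⊞ F.P.obj B) = F.P.map (f ▷⊞ B) ≫ F.nPar A' B :=
  @Functor.OplaxMonoidal.δ_natural_left X _ TwoMonoidal.par Y _ TwoMonoidal.par F.P F.oplax
    _ _ f B

lemma nPar_natural_right (A : X) {B B' : X} (f : B ⟶ B') :
    F.nPar A B ≫ (F.P.obj A ◁⊞ F.P.map f) = F.P.map (A ◁⊞ f) ≫ F.nPar A B' :=
  @Functor.OplaxMonoidal.δ_natural_right X _ TwoMonoidal.par Y _ TwoMonoidal.par F.P F.oplax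
    _ _ A f

end

end LinearFunctorData

namespace LinearFunctor

section Naturality

variable [LinDistCategory X] [LinDistCategory Y] (F : LinearFunctor X Y)

lemma νRT_natural_left {A A' : X} (f : A ⟶ A') (B : X) :
    F.νRT A B ≫ (F.P.map f ▷⊞ F.T.obj B) = F.T.map (f ▷⊞ B) ≫ F.νRT A' B := by
  simpa only [F.T.map_id, MonoidalCategory.tensorHom_id] using (F.νRT_natural f (𝟙 B)).symm

lemma νRT_natural_right (A : X) {B B' : X} (f : B ⟶ B') :
    F.νRT A B ≫ (F.P.obj A ◁⊞ F.T.map f) = F.T.map (A ◁⊞ f) ≫ F.νRT A B' := by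
  simpa only [F.P.map_id, MonoidalCategory.id_tensorHom] using (F.νRT_natural (𝟙 A) f).symm

lemma νLT_natural_left {A A' : X} (f : A ⟶ A') (B : X) :
    F.νLT A B ≫ (F.T.map f ▷⊞ F.P.obj B) = F.T.map (f ▷⊞ B) ≫ F.νLT A' B := by
  simpa only [F.P.map_id, MonoidalCategory.tensorHom_id] using (F.νLT_natural f (𝟙 B)).symm

lemma νLT_natural_right (A : X) {B B' : X} (f : B ⟶ B') :
    F.νLT A B ≫ (F.T.obj A ◁⊞ F.P.map f) = F.T.map (A ◁⊞ f) ≫ F.νLT A B' := by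
  simpa only [F.T.map_id, MonoidalCategory.id_tensorHom] using (F.νLT_natural (𝟙 A) f).symm

lemma νRP_natural_left {A A' : X} (f : A ⟶ A') (B : X) :
    (F.T.map f ▷⊠ F.P.obj B) ≫ F.νRP A' B = F.νRP A B ≫ F.P.map (f ▷⊠ B) := by
  simpa only [F.P.map_id, MonoidalCategory.tensorHom_id] using F.νRP_natural f (𝟙 B)

lemma νRP_natural_right (A : X) {B B' : X} (f : B ⟶ B') :
    (F.T.obj A ◁⊠ F.P.map f) ≫ F.νRP A B' = F.νRP A B ≫ F.P.map (A ◁⊠ f) := by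
  simpa only [F.T.map_id, MonoidalCategory.id_tensorHom] using F.νRP_natural (𝟙 A) f

lemma νLP_natural_left {A A' : X} (f : A ⟶ A') (B : X) :
    (F.P.map f ▷⊠ F.T.obj B) ≫ F.νLP A' B = F.νLP A B ≫ F.P.map (f ▷⊠ B) := by
  simpa only [F.T.map_id, MonoidalCategory.tensorHom_id] using F.νLP_natural f (𝟙 B)

lemma νLP_natural_right (A : X) {B B' : X} (f : B ⟶ B') :
    (F.P.obj A ◁⊠ F.T.map f) ≫ F.νLP A B' = F.νLP A B ≫ F.P.map (A ◁⊠ f) := by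
  simpa only [F.P.map_id, MonoidalCategory.id_tensorHom] using F.νLP_natural (𝟙 A) f

end Naturality

/-- The identity linear functor. -/
def id (X : Type u₁) [Category.{v₁} X] [LinDistCategory X] : LinearFunctor X X where
  toLinearFunctorData := LinearFunctorData.id X
  νRT_natural f g := by simp
  νLT_natural f g := by simp
  νRP_natural f g := by simp
  νLP_natural f g := by simp
  νRT_unit A := by simp
  νLT_unit A := by simp
  νRP_unit A := by simp
  νLP_unit A := by simp
  νRT_assoc A B C := by simp
  νLT_assoc A B C := by simp
  νRP_assoc A B C := by simp
  νLP_assoc A B C := by simp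
  mTen_δR_νRT A B C := by simp
  mTen_δL_νLT A B C := by simp
  νRP_δL_nPar A B C := by simp
  νLP_δR_nPar A B C := by simp
  νRT_νLT A B C := by simp
  νLP_νRP A B C := by simp
  mTen_δL_νRT A B C := by simp
  mTen_δR_νLT A B C := by simp
  νRP_δR_nPar A B C := by simp
  νLP_δL_nPar A B C := by simp

variable [LinDistCategory X] [LinDistCategory Y] [LinDistCategory Z]

/-- The composite of linear functors. -/
def comp (F : LinearFunctor X Y) (G : LinearFunctor Y Z) : LinearFunctor X Z where
  toLinearFunctorData := F.toLinearFunctorData.comp G.toLinearFunctorData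
  νRT_natural f g := by
    dsimp
    rw [Category.assoc, ← G.νRT_natural, ← G.T.map_comp_assoc, ← G.T.map_comp_assoc,
      F.νRT_natural]
  νLT_natural f g := by
    dsimp
    rw [Category.assoc, ← G.νLT_natural, ← G.T.map_comp_assoc, ← G.T.map_comp_assoc,
      F.νLT_natural]
  νRP_natural f g := by
    dsimp
    rw [Category.assoc, reassoc_of% G.νRP_natural, ← G.P.map_comp, ← G.P.map_comp,
      F.νRP_natural]
  νLP_natural f g := by
    dsimp
    rw [Category.assoc, reassoc_of% G.νLP_natural, ← G.P.map_comp, ← G.P.map_comp,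
      F.νLP_natural]
  νRT_unit A := by
    dsimp
    simp only [MonoidalCategory.comp_whiskerRight, Category.assoc]
    rw [reassoc_of% G.νRT_natural_left, G.νRT_unit, ← F.νRT_unit]
    simp only [Functor.map_comp]
  νLT_unit A := by
    dsimp
    simp only [MonoidalCategory.whiskerLeft_comp, Category.assoc]
    rw [reassoc_of% G.νLT_natural_right, G.νLT_unit, ← F.νLT_unit]
    simp only [Functor.map_comp]
  νRP_unit A := by
    dsimp
    simp only [MonoidalCategory.comp_whiskerRight, Category.assoc]
    rw [reassoc_of% G.νRP_natural_left, reassoc_of% G.νRP_unit, ← F.νRP_unit]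
    simp only [Functor.map_comp]
  νLP_unit A := by
    dsimp
    simp only [MonoidalCategory.whiskerLeft_comp, Category.assoc]
    rw [reassoc_of% G.νLP_natural_right, reassoc_of% G.νLP_unit, ← F.νLP_unit]
    simp only [Functor.map_comp]
  νRT_assoc A B C := by
    dsimp
    simp only [MonoidalCategory.comp_whiskerRight, MonoidalCategory.whiskerLeft_comp,
      Category.assoc]
    rw [reassoc_of% G.νRT_natural_right, reassoc_of% G.νRT_natural_left, G.νRT_assoc]
    simp only [← Functor.map_comp_assoc]
    rw [F.νRT_assoc]
  νLT_assoc A B C := by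
    dsimp
    simp only [MonoidalCategory.comp_whiskerRight, MonoidalCategory.whiskerLeft_comp,
      Category.assoc]
    rw [reassoc_of% G.νLT_natural_right, reassoc_of% G.νLT_natural_left, G.νLT_assoc]
    simp only [← Functor.map_comp_assoc]
    rw [F.νLT_assoc]
  νRP_assoc A B C := by
    dsimp
    simp only [MonoidalCategory.comp_whiskerRight, MonoidalCategory.whiskerLeft_comp,
      Category.assoc]
    rw [reassoc_of% G.νRP_natural_right, reassoc_of% G.νRP_natural_left, reassoc_of% G.νRP_assoc]
    simp only [← Functor.map_comp]
    rw [F.νRP_assoc]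
  νLP_assoc A B C := by
    dsimp
    simp only [MonoidalCategory.comp_whiskerRight, MonoidalCategory.whiskerLeft_comp,
      Category.assoc]
    rw [reassoc_of% G.νLP_natural_right, reassoc_of% G.νLP_natural_left, reassoc_of% G.νLP_assoc]
    simp only [← Functor.map_comp]
    rw [F.νLP_assoc]
  mTen_δR_νRT A B C := by
    dsimp
    simp only [MonoidalCategory.comp_whiskerRight, MonoidalCategory.whiskerLeft_comp,
      Category.assoc]
    rw [← reassoc_of% G.mTen_δR_νRT, G.νRT_natural_right, reassoc_of% G.mTen_natural_left]
    simp only [← Functor.map_comp_assoc]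
    rw [F.mTen_δR_νRT]
  mTen_δL_νLT A B C := by
    dsimp
    simp only [MonoidalCategory.comp_whiskerRight, MonoidalCategory.whiskerLeft_comp,
      Category.assoc]
    rw [← reassoc_of% G.mTen_δL_νLT, G.νLT_natural_left, reassoc_of% G.mTen_natural_right]
    simp only [← Functor.map_comp_assoc]
    rw [F.mTen_δL_νLT]
  νRP_δL_nPar A B C := by
    dsimp
    simp only [MonoidalCategory.comp_whiskerRight, MonoidalCategory.whiskerLeft_comp,
      Category.assoc]
    rw [← reassoc_of% G.νRP_δL_nPar, G.nPar_natural_left, reassoc_of% G.νRP_natural_right]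
    simp only [← Functor.map_comp_assoc]
    rw [F.νRP_δL_nPar]
  νLP_δR_nPar A B C := by
    dsimp
    simp only [MonoidalCategory.comp_whiskerRight, MonoidalCategory.whiskerLeft_comp,
      Category.assoc]
    rw [← reassoc_of% G.νLP_δR_nPar, G.nPar_natural_right, reassoc_of% G.νLP_natural_left]
    simp only [← Functor.map_comp_assoc]
    rw [F.νLP_δR_nPar]
  νRT_νLT A B C := by
    dsimp
    simp only [MonoidalCategory.comp_whiskerRight, MonoidalCategory.whiskerLeft_comp,
      Category.assoc]
    rw [reassoc_of% G.νRT_natural_right, reassoc_of% G.νLT_natural_left, G.νRT_νLT]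
    simp only [← Functor.map_comp_assoc]
    rw [F.νRT_νLT]
  νLP_νRP A B C := by
    dsimp
    simp only [MonoidalCategory.comp_whiskerRight, MonoidalCategory.whiskerLeft_comp,
      Category.assoc]
    rw [reassoc_of% G.νRP_natural_right, reassoc_of% G.νLP_natural_left, reassoc_of% G.νLP_νRP]
    simp only [← Functor.map_comp]
    rw [F.νLP_νRP]
  mTen_δL_νRT A B C := by
    dsimp
    simp only [MonoidalCategory.comp_whiskerRight, MonoidalCategory.whiskerLeft_comp,
      Category.assoc]
    rw [← reassoc_of% G.mTen_δL_νRT, G.νRT_natural_left, reassoc_of% G.mTen_natural_right]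
    simp only [← Functor.map_comp_assoc]
    rw [F.mTen_δL_νRT]
  mTen_δR_νLT A B C := by
    dsimp
    simp only [MonoidalCategory.comp_whiskerRight, MonoidalCategory.whiskerLeft_comp,
      Category.assoc]
    rw [← reassoc_of% G.mTen_δR_νLT, G.νLT_natural_right, reassoc_of% G.mTen_natural_left]
    simp only [← Functor.map_comp_assoc]
    rw [F.mTen_δR_νLT]
  νRP_δR_nPar A B C := by
    dsimp
    simp only [MonoidalCategory.comp_whiskerRight, MonoidalCategory.whiskerLeft_comp,
      Category.assoc]
    rw [← reassoc_of% G.νRP_δR_nPar, G.nPar_natural_right, reassoc_of% G.νRP_natural_left]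
    simp only [← Functor.map_comp_assoc]
    rw [F.νRP_δR_nPar]
  νLP_δL_nPar A B C := by
    dsimp
    simp only [MonoidalCategory.comp_whiskerRight, MonoidalCategory.whiskerLeft_comp,
      Category.assoc]
    rw [← reassoc_of% G.νLP_δL_nPar, G.nPar_natural_left, reassoc_of% G.νLP_natural_right]
    simp only [← Functor.map_comp_assoc]
    rw [F.νLP_δL_nPar]

end LinearFunctor

end Composition

section StrongComposition

variable {X : Type u₁} [Category.{v₁} X] {Y : Type u₂} [Category.{v₂} Y]
  {Z : Type u₃} [Category.{v₃} Z]
variable [SymmLinDistCategory X] [SymmLinDistCategory Y] [SymmLinDistCategory Z]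

namespace StrongSymmLinearFunctor

/-- The identity strong symmetric linear functor. -/
def id (X : Type u₁) [Category.{v₁} X] [SymmLinDistCategory X] :
    StrongSymmLinearFunctor X X where
  toLinearFunctor := LinearFunctor.id X
  isIso_mTop := inferInstanceAs (IsIso (𝟙 _))
  isIso_mTen A B := inferInstanceAs (IsIso (𝟙 _))
  isIso_nBot := inferInstanceAs (IsIso (𝟙 _))
  isIso_nPar A B := inferInstanceAs (IsIso (𝟙 _))
  mTen_braiding A B := by dsimp [LinearFunctor.id]; simp
  nPar_braiding A B := by dsimp [LinearFunctor.id]; simp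
  νRT_braiding A B := by dsimp [LinearFunctor.id]; simp
  νRP_braiding A B := by dsimp [LinearFunctor.id]; simp

/-- The composite of strong symmetric linear functors. -/
def comp (F : StrongSymmLinearFunctor X Y) (G : StrongSymmLinearFunctor Y Z) :
    StrongSymmLinearFunctor X Z where
  toLinearFunctor := F.toLinearFunctor.comp G.toLinearFunctor
  isIso_mTop := inferInstanceAs (IsIso (G.mTop ≫ G.T.map F.mTop))
  isIso_mTen A B := inferInstanceAs (IsIso (G.mTen _ _ ≫ G.T.map (F.mTen A B)))
  isIso_nBot := inferInstanceAs (IsIso (G.P.map F.nBot ≫ G.nBot))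
  isIso_nPar A B := inferInstanceAs (IsIso (G.P.map (F.nPar A B) ≫ G.nPar _ _))
  mTen_braiding A B := by
    dsimp [LinearFunctor.comp]
    rw [← reassoc_of% G.mTen_braiding, Category.assoc, ← Functor.map_comp, F.mTen_braiding,
      Functor.map_comp]
  nPar_braiding A B := by
    dsimp [LinearFunctor.comp]
    rw [Category.assoc, G.nPar_braiding, ← Functor.map_comp_assoc, F.nPar_braiding,
      Functor.map_comp_assoc]
  νRT_braiding A B := by
    dsimp [LinearFunctor.comp]
    rw [Category.assoc, G.νRT_braiding, ← Functor.map_comp_assoc, F.νRT_braiding,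
      Functor.map_comp_assoc]
  νRP_braiding A B := by
    dsimp [LinearFunctor.comp]
    rw [← reassoc_of% G.νRP_braiding, Category.assoc, ← Functor.map_comp, F.νRP_braiding,
      Functor.map_comp]

@[simp] lemma id_toData :
    (StrongSymmLinearFunctor.id X).toLinearFunctorData = LinearFunctorData.id X := rfl

@[simp] lemma comp_toData (F : StrongSymmLinearFunctor X Y) (G : StrongSymmLinearFunctor Y Z) :
    (F.comp G).toLinearFunctorData = F.toLinearFunctorData.comp G.toLinearFunctorData := rfl

end StrongSymmLinearFunctor

namespace MedialFunctorData

/-- The identity functor with its identity structure. -/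
def id (X : Type u₁) [Category.{v₁} X] [SymmLinDistCategory X] :
    MedialFunctorData (StrongSymmLinearFunctor.id X) where
  parLax := @Functor.LaxMonoidal.id X _ TwoMonoidal.par
  tenOplax := @Functor.OplaxMonoidal.id X _ TwoMonoidal.tensor

/-- The composite structure. -/
def comp {F : StrongSymmLinearFunctor X Y} {G : StrongSymmLinearFunctor Y Z}
    (M : MedialFunctorData F) (N : MedialFunctorData G) : MedialFunctorData (F.comp G) where
  parLax := @Functor.LaxMonoidal.comp X _ TwoMonoidal.par Y _ TwoMonoidal.par
    Z _ TwoMonoidal.par F.T G.T M.parLax N.parLax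
  tenOplax := @Functor.OplaxMonoidal.comp X _ TwoMonoidal.tensor Y _ TwoMonoidal.tensor
    Z _ TwoMonoidal.tensor F.P G.P M.tenOplax N.tenOplax

@[simp] lemma id_mBot : (id X).mBot = 𝟙 _ := rfl
@[simp] lemma id_mPar (A B : X) : (id X).mPar A B = 𝟙 _ := rfl
@[simp] lemma id_nTop : (id X).nTop = 𝟙 _ := rfl
@[simp] lemma id_nTen (A B : X) : (id X).nTen A B = 𝟙 _ := rfl

section

variable {F : StrongSymmLinearFunctor X Y} {G : StrongSymmLinearFunctor Y Z}
  (M : MedialFunctorData F) (N : MedialFunctorData G)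

@[simp] lemma comp_mBot : (M.comp N).mBot = N.mBot ≫ G.T.map M.mBot := rfl
@[simp] lemma comp_mPar (A B : X) :
    (M.comp N).mPar A B = N.mPar _ _ ≫ G.T.map (M.mPar A B) := rfl
@[simp] lemma comp_nTop : (M.comp N).nTop = G.P.map M.nTop ≫ N.nTop := rfl
@[simp] lemma comp_nTen (A B : X) :
    (M.comp N).nTen A B = G.P.map (M.nTen A B) ≫ N.nTen _ _ := rfl

lemma mPar_natural {A A' B B' : X} (f : A ⟶ A') (g : B ⟶ B') :
    (F.T.map f ⊞ₕ F.T.map g) ≫ M.mPar A' B' = M.mPar A B ≫ F.T.map (f ⊞ₕ g) :=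
  @Functor.LaxMonoidal.μ_natural X _ TwoMonoidal.par Y _ TwoMonoidal.par F.T M.parLax
    _ _ _ _ f g

lemma nTen_natural {A A' B B' : X} (f : A ⟶ A') (g : B ⟶ B') :
    M.nTen A B ≫ (F.P.map f ⊠ₕ F.P.map g) = F.P.map (f ⊠ₕ g) ≫ M.nTen A' B' :=
  @Functor.OplaxMonoidal.δ_natural X _ TwoMonoidal.tensor Y _ TwoMonoidal.tensor F.P M.tenOplax
    _ _ _ _ f g

lemma mPar_natural_left {A A' : X} (f : A ⟶ A') (B : X) :
    (F.T.map f ▷⊞ F.T.obj B) ≫ M.mPar A' B = M.mPar A B ≫ F.T.map (f ▷⊞ B) :=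
  @Functor.LaxMonoidal.μ_natural_left X _ TwoMonoidal.par Y _ TwoMonoidal.par F.T M.parLax
    _ _ f B

lemma nTen_natural_left {A A' : X} (f : A ⟶ A') (B : X) :
    M.nTen A B ≫ (F.P.map f ▷⊠ F.P.obj B) = F.P.map (f ▷⊠ B) ≫ M.nTen A' B :=
  @Functor.OplaxMonoidal.δ_natural_left X _ TwoMonoidal.tensor Y _ TwoMonoidal.tensor F.P
    M.tenOplax _ _ f B

end

end MedialFunctorData

namespace MedialFunctorStructure

variable [MedialStructure X] [MedialStructure Y] [MedialStructure Z]

/-- The identity functor is a medial linear functor. -/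
def id (X : Type u₁) [Category.{v₁} X] [SymmLinDistCategory X] [MedialStructure X] :
    MedialFunctorStructure (StrongSymmLinearFunctor.id X) where
  toMedialFunctorData := MedialFunctorData.id X
  mPar_braiding A B := by dsimp; simp
  nTen_braiding A B := by dsimp; simp
  T_Δbot := by dsimp; simp
  T_nablaTop := by dsimp; simp
  T_mix := by dsimp; simp
  T_med A B C D := by dsimp; simp
  P_Δbot := by dsimp; simp
  P_nablaTop := by dsimp; simp
  P_mix := by dsimp; simp
  P_med A B C D := by dsimp; simp
  νRP_Δbot := by dsimp; simp
  νRT_nablaTop := by dsimp; simp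
  νRT_med A B C D := by dsimp; simp
  νRP_med A B C D := by dsimp; simp
  mPar_νRT A B C := by dsimp; simp
  νRP_nTen A B C := by dsimp; simp

/-- The composite of medial linear functors is a medial linear functor. -/
def comp {F : StrongSymmLinearFunctor X Y} {G : StrongSymmLinearFunctor Y Z}
    (M : MedialFunctorStructure F) (N : MedialFunctorStructure G) :
    MedialFunctorStructure (F.comp G) where
  toMedialFunctorData := M.toMedialFunctorData.comp N.toMedialFunctorData
  mPar_braiding A B := by
    dsimp
    rw [← reassoc_of% N.mPar_braiding, Category.assoc, ← Functor.map_comp, M.mPar_braiding,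
      Functor.map_comp]
  nTen_braiding A B := by
    dsimp
    rw [Category.assoc, N.nTen_braiding, ← Functor.map_comp_assoc, M.nTen_braiding,
      Functor.map_comp_assoc]
  T_Δbot := by
    dsimp
    simp only [← MonoidalCategory.tensorHom_comp_tensorHom, Category.assoc]
    rw [reassoc_of% G.mTen_natural, reassoc_of% N.T_Δbot]
    simp only [← Functor.map_comp]
    rw [M.T_Δbot]
  T_nablaTop := by
    dsimp
    simp only [← MonoidalCategory.tensorHom_comp_tensorHom, Category.assoc]
    rw [reassoc_of% N.mPar_natural, ← reassoc_of% N.T_nablaTop]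
    simp only [← Functor.map_comp]
    rw [M.T_nablaTop]
  T_mix := by
    dsimp
    rw [reassoc_of% N.T_mix, ← Functor.map_comp, M.T_mix, Functor.map_comp, Category.assoc]
  T_med A B C D := by
    dsimp
    simp only [← MonoidalCategory.tensorHom_comp_tensorHom, Category.assoc]
    rw [reassoc_of% N.mPar_natural, reassoc_of% G.mTen_natural, ← reassoc_of% N.T_med]
    simp only [← Functor.map_comp]
    rw [M.T_med]
  P_Δbot := by
    dsimp
    simp only [← MonoidalCategory.tensorHom_comp_tensorHom, Category.assoc]
    rw [reassoc_of% N.nTen_natural, ← N.P_Δbot]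
    simp only [← Functor.map_comp_assoc]
    rw [M.P_Δbot]
  P_nablaTop := by
    dsimp
    simp only [← MonoidalCategory.tensorHom_comp_tensorHom, Category.assoc]
    rw [reassoc_of% G.nPar_natural, N.P_nablaTop]
    simp only [← Functor.map_comp_assoc]
    rw [M.P_nablaTop]
  P_mix := by
    dsimp
    rw [Category.assoc, N.P_mix, ← Functor.map_comp_assoc, M.P_mix, Functor.map_comp_assoc]
  P_med A B C D := by
    dsimp
    simp only [← MonoidalCategory.tensorHom_comp_tensorHom, Category.assoc]
    rw [reassoc_of% N.nTen_natural, reassoc_of% G.nPar_natural, ← N.P_med]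
    simp only [← Functor.map_comp_assoc]
    rw [M.P_med]
  νRP_Δbot := by
    dsimp
    simp only [IsIso.inv_comp, ← Functor.map_inv, ← MonoidalCategory.tensorHom_comp_tensorHom,
      Category.assoc]
    rw [reassoc_of% G.νRP_natural, ← reassoc_of% N.νRP_Δbot, M.νRP_Δbot]
    simp only [Functor.map_comp]
  νRT_nablaTop := by
    dsimp
    simp only [IsIso.inv_comp, ← Functor.map_inv, ← MonoidalCategory.tensorHom_comp_tensorHom,
      Category.assoc]
    rw [← reassoc_of% G.νRT_natural, ← reassoc_of% N.νRT_nablaTop, M.νRT_nablaTop]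
    simp only [Functor.map_comp]
  νRT_med A B C D := by
    dsimp
    simp only [IsIso.inv_comp, ← Functor.map_inv, ← MonoidalCategory.tensorHom_comp_tensorHom,
      Category.assoc]
    have h : inv (G.mTen (F.T.obj (A ⊞ C)) (F.T.obj (B ⊞ D))) ≫
        (G.T.map (F.νRT A C) ⊠ₕ G.T.map (F.νRT B D)) =
        G.T.map (F.νRT A C ⊠ₕ F.νRT B D) ≫ inv (G.mTen _ _) := by
      rw [IsIso.inv_comp_eq, ← reassoc_of% G.mTen_natural, IsIso.hom_inv_id, Category.comp_id]
    rw [reassoc_of% h, ← reassoc_of% G.νRT_natural, ← N.νRT_med]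
    simp only [← Functor.map_comp_assoc]
    rw [M.νRT_med]
  νRP_med A B C D := by
    dsimp
    simp only [IsIso.inv_comp, ← Functor.map_inv, ← MonoidalCategory.tensorHom_comp_tensorHom,
      Category.assoc]
    have h : (G.P.map (F.νRP A B) ⊞ₕ G.P.map (F.νRP C D)) ≫
        inv (G.nPar (F.P.obj (A ⊠ B)) (F.P.obj (C ⊠ D))) =
        inv (G.nPar _ _) ≫ G.P.map (F.νRP A B ⊞ₕ F.νRP C D) := by
      rw [IsIso.eq_inv_comp, reassoc_of% G.nPar_natural, IsIso.hom_inv_id, Category.comp_id]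
    rw [reassoc_of% h, reassoc_of% G.νRP_natural, ← reassoc_of% N.νRP_med]
    simp only [← Functor.map_comp]
    rw [M.νRP_med]
  mPar_νRT A B C := by
    dsimp
    simp only [MonoidalCategory.comp_whiskerRight, MonoidalCategory.whiskerLeft_comp,
      Category.assoc]
    rw [← reassoc_of% N.mPar_νRT, G.νRT_natural_right, reassoc_of% N.mPar_natural_left]
    simp only [← Functor.map_comp_assoc]
    rw [M.mPar_νRT]
  νRP_nTen A B C := by
    dsimp
    simp only [MonoidalCategory.comp_whiskerRight, MonoidalCategory.whiskerLeft_comp,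
      Category.assoc]
    rw [← reassoc_of% N.νRP_nTen, N.nTen_natural_left, reassoc_of% G.νRP_natural_right]
    simp only [← Functor.map_comp_assoc]
    rw [M.νRP_nTen]

end MedialFunctorStructure

end StrongComposition

section Transformations

variable {X : Type u₁} [Category.{v₁} X] {Y : Type u₂} [Category.{v₂} Y]
  {Z : Type u₃} [Category.{v₃} Z]

namespace LinearTransformation

variable [LinDistCategory X] [LinDistCategory Y] [LinDistCategory Z]

/-- The identity linear transformation. -/
def id (F : LinearFunctor X Y) : LinearTransformation F F where
  t := 𝟙 _
  p := 𝟙 _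
  t_mTop := by simp
  t_mTen A B := by simp
  p_nBot := by simp
  p_nPar A B := by simp
  νRT_comm A B := by simp
  νLT_comm A B := by simp
  νLP_comm A B := by simp
  νRP_comm A B := by simp

/-- The vertical composite of linear transformations. -/
def vcomp {F G H : LinearFunctor X Y} (α : LinearTransformation F G)
    (β : LinearTransformation G H) : LinearTransformation F H where
  t := α.t ≫ β.t
  p := β.p ≫ α.p
  t_mTop := by rw [NatTrans.comp_app, reassoc_of% α.t_mTop, β.t_mTop]
  t_mTen A B := by
    simp only [NatTrans.comp_app, ← MonoidalCategory.tensorHom_comp_tensorHom, Category.assoc]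
    rw [reassoc_of% α.t_mTen, β.t_mTen]
  p_nBot := by rw [NatTrans.comp_app, Category.assoc, α.p_nBot, β.p_nBot]
  p_nPar A B := by
    simp only [NatTrans.comp_app, ← MonoidalCategory.tensorHom_comp_tensorHom, Category.assoc]
    rw [α.p_nPar, reassoc_of% β.p_nPar]
  νRT_comm A B := by
    simp only [NatTrans.comp_app, MonoidalCategory.comp_whiskerRight,
      MonoidalCategory.whiskerLeft_comp, Category.assoc]
    rw [reassoc_of% β.νRT_comm, ← reassoc_of% α.νRT_comm]
    simp only [MonoidalCategory.whisker_exchange]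
  νLT_comm A B := by
    simp only [NatTrans.comp_app, MonoidalCategory.comp_whiskerRight,
      MonoidalCategory.whiskerLeft_comp, Category.assoc]
    rw [reassoc_of% β.νLT_comm, ← reassoc_of% α.νLT_comm]
    simp only [MonoidalCategory.whisker_exchange]
  νLP_comm A B := by
    simp only [NatTrans.comp_app, MonoidalCategory.comp_whiskerRight,
      MonoidalCategory.whiskerLeft_comp, Category.assoc]
    rw [reassoc_of% β.νLP_comm, ← α.νLP_comm]
    simp only [MonoidalCategory.whisker_exchange_assoc]
  νRP_comm A B := by
    simp only [NatTrans.comp_app, MonoidalCategory.comp_whiskerRight,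
      MonoidalCategory.whiskerLeft_comp, Category.assoc]
    rw [reassoc_of% β.νRP_comm, ← α.νRP_comm]
    simp only [MonoidalCategory.whisker_exchange_assoc]

/-- Precomposition of a linear transformation with a linear functor. -/
def whiskerLeft (F : LinearFunctor X Y) {G H : LinearFunctor Y Z}
    (β : LinearTransformation G H) : LinearTransformation (F.comp G) (F.comp H) where
  t := Functor.whiskerLeft F.T β.t
  p := Functor.whiskerLeft F.P β.p
  t_mTop := by
    dsimp [LinearFunctor.comp]
    rw [Category.assoc, β.t.naturality, reassoc_of% β.t_mTop]
  t_mTen A B := by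
    dsimp [LinearFunctor.comp]
    rw [Category.assoc, β.t.naturality, reassoc_of% β.t_mTen]
  p_nBot := by
    dsimp [LinearFunctor.comp]
    rw [← β.p.naturality_assoc, β.p_nBot]
  p_nPar A B := by
    dsimp [LinearFunctor.comp]
    rw [← β.p.naturality_assoc, β.p_nPar, Category.assoc]
  νRT_comm A B := by
    dsimp [LinearFunctor.comp]
    simp only [Category.assoc]
    rw [← β.t.naturality_assoc, β.νRT_comm]
  νLT_comm A B := by
    dsimp [LinearFunctor.comp]
    simp only [Category.assoc]
    rw [← β.t.naturality_assoc, β.νLT_comm]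
  νLP_comm A B := by
    dsimp [LinearFunctor.comp]
    simp only [Category.assoc]
    rw [β.p.naturality, reassoc_of% β.νLP_comm]
  νRP_comm A B := by
    dsimp [LinearFunctor.comp]
    simp only [Category.assoc]
    rw [β.p.naturality, reassoc_of% β.νRP_comm]

/-- Postcomposition of a linear transformation with a linear functor. -/
def whiskerRight {F G : LinearFunctor X Y} (α : LinearTransformation F G)
    (H : LinearFunctor Y Z) : LinearTransformation (F.comp H) (G.comp H) where
  t := Functor.whiskerRight α.t H.T
  p := Functor.whiskerRight α.p H.P
  t_mTop := by
    dsimp [LinearFunctor.comp]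
    rw [Category.assoc, ← Functor.map_comp, α.t_mTop]
  t_mTen A B := by
    dsimp [LinearFunctor.comp]
    rw [Category.assoc, ← Functor.map_comp, α.t_mTen, Functor.map_comp,
      reassoc_of% H.mTen_natural]
  p_nBot := by
    dsimp [LinearFunctor.comp]
    rw [← Functor.map_comp_assoc, α.p_nBot]
  p_nPar A B := by
    dsimp [LinearFunctor.comp]
    rw [← Functor.map_comp_assoc, α.p_nPar, Functor.map_comp, Category.assoc, Category.assoc,
      H.nPar_natural]
  νRT_comm A B := by
    dsimp [LinearFunctor.comp]
    simp only [Category.assoc]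
    rw [H.νRT_natural_left, H.νRT_natural_right]
    simp only [← Functor.map_comp_assoc]
    rw [α.νRT_comm]
  νLT_comm A B := by
    dsimp [LinearFunctor.comp]
    simp only [Category.assoc]
    rw [H.νLT_natural_left, H.νLT_natural_right]
    simp only [← Functor.map_comp_assoc]
    rw [α.νLT_comm]
  νLP_comm A B := by
    dsimp [LinearFunctor.comp]
    rw [Category.assoc, reassoc_of% H.νLP_natural_left, reassoc_of% H.νLP_natural_right]
    simp only [← Functor.map_comp]
    rw [α.νLP_comm]
  νRP_comm A B := by
    dsimp [LinearFunctor.comp]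
    rw [Category.assoc, reassoc_of% H.νRP_natural_left, reassoc_of% H.νRP_natural_right]
    simp only [← Functor.map_comp]
    rw [α.νRP_comm]

end LinearTransformation

namespace IsMedialTransformation

variable [SymmLinDistCategory X] [SymmLinDistCategory Y] [SymmLinDistCategory Z]

lemma id {F : StrongSymmLinearFunctor X Y} (M : MedialFunctorData F) :
    IsMedialTransformation M M (LinearTransformation.id F.toLinearFunctor) where
  t_mBot := by simp [LinearTransformation.id]
  t_mPar A B := by simp [LinearTransformation.id]
  p_nTop := by simp [LinearTransformation.id]
  p_nTen A B := by simp [LinearTransformation.id]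

lemma vcomp {F G H : StrongSymmLinearFunctor X Y} {M : MedialFunctorData F}
    {N : MedialFunctorData G} {K : MedialFunctorData H}
    {α : LinearTransformation F.toLinearFunctor G.toLinearFunctor}
    {β : LinearTransformation G.toLinearFunctor H.toLinearFunctor}
    (hα : IsMedialTransformation M N α) (hβ : IsMedialTransformation N K β) :
    IsMedialTransformation M K (α.vcomp β) where
  t_mBot := by
    dsimp [LinearTransformation.vcomp]
    rw [reassoc_of% hα.t_mBot, hβ.t_mBot]
  t_mPar A B := by
    dsimp [LinearTransformation.vcomp]
    simp only [← MonoidalCategory.tensorHom_comp_tensorHom, Category.assoc]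
    rw [reassoc_of% hα.t_mPar, hβ.t_mPar]
  p_nTop := by
    dsimp [LinearTransformation.vcomp]
    rw [Category.assoc, hα.p_nTop, hβ.p_nTop]
  p_nTen A B := by
    dsimp [LinearTransformation.vcomp]
    simp only [← MonoidalCategory.tensorHom_comp_tensorHom, Category.assoc]
    rw [hα.p_nTen, reassoc_of% hβ.p_nTen]

lemma whiskerLeft {F : StrongSymmLinearFunctor X Y} (M : MedialFunctorData F)
    {G H : StrongSymmLinearFunctor Y Z} {N : MedialFunctorData G} {K : MedialFunctorData H}
    {β : LinearTransformation G.toLinearFunctor H.toLinearFunctor}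
    (hβ : IsMedialTransformation N K β) :
    IsMedialTransformation (F := F.comp G) (G := F.comp H) (M.comp N) (M.comp K)
      (LinearTransformation.whiskerLeft F.toLinearFunctor β) where
  t_mBot := by
    dsimp [LinearTransformation.whiskerLeft]
    rw [Category.assoc, β.t.naturality, reassoc_of% hβ.t_mBot]
  t_mPar A B := by
    dsimp [LinearTransformation.whiskerLeft]
    rw [Category.assoc, β.t.naturality, reassoc_of% hβ.t_mPar]
  p_nTop := by
    dsimp [LinearTransformation.whiskerLeft]
    rw [← β.p.naturality_assoc, hβ.p_nTop]
  p_nTen A B := by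
    dsimp [LinearTransformation.whiskerLeft]
    rw [← β.p.naturality_assoc, hβ.p_nTen, Category.assoc]

lemma whiskerRight {F G : StrongSymmLinearFunctor X Y} {M : MedialFunctorData F}
    {N : MedialFunctorData G} {α : LinearTransformation F.toLinearFunctor G.toLinearFunctor}
    (hα : IsMedialTransformation M N α)
    {H : StrongSymmLinearFunctor Y Z} (K : MedialFunctorData H) :
    IsMedialTransformation (F := F.comp H) (G := G.comp H) (M.comp K) (N.comp K)
      (LinearTransformation.whiskerRight α H.toLinearFunctor) where
  t_mBot := by
    dsimp [LinearTransformation.whiskerRight]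
    rw [Category.assoc, ← Functor.map_comp, hα.t_mBot]
  t_mPar A B := by
    dsimp [LinearTransformation.whiskerRight]
    rw [Category.assoc, ← Functor.map_comp, hα.t_mPar, Functor.map_comp,
      reassoc_of% K.mPar_natural]
  p_nTop := by
    dsimp [LinearTransformation.whiskerRight]
    rw [← Functor.map_comp_assoc, hα.p_nTop]
  p_nTen A B := by
    dsimp [LinearTransformation.whiskerRight]
    rw [← Functor.map_comp_assoc, hα.p_nTen, Functor.map_comp, Category.assoc, Category.assoc,
      K.nTen_natural]

end IsMedialTransformation

end Transformations

/-! ## Unit and associativity laws of the composition of functors -/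

section StrictLaws

variable {X : Type u₁} [Category.{v₁} X] {Y : Type u₂} [Category.{v₂} Y]

lemma LinearFunctorData.ext_of_heq [TwoMonoidal X] [TwoMonoidal Y] {F G : LinearFunctorData X Y}
    (hT : F.T = G.T) (hP : F.P = G.P) (hmTop : HEq F.mTop G.mTop) (hmTen : HEq F.mTen G.mTen)
    (hnBot : HEq F.nBot G.nBot) (hnPar : HEq F.nPar G.nPar) (hνRT : HEq F.νRT G.νRT)
    (hνLT : HEq F.νLT G.νLT) (hνRP : HEq F.νRP G.νRP) (hνLP : HEq F.νLP G.νLP) : F = G := by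
  obtain ⟨T, P, lax, oplax, _, _, _, _⟩ := F
  obtain ⟨T', P', lax', oplax', _, _, _, _⟩ := G
  dsimp only at hT hP
  subst hT hP
  obtain rfl : lax = lax' := by
    apply Functor.LaxMonoidal.ext
    · exact eq_of_heq hmTop
    · exact eq_of_heq hmTen
  obtain rfl : oplax = oplax' := by
    apply Functor.OplaxMonoidal.ext
    · exact eq_of_heq hnBot
    · exact eq_of_heq hnPar
  cases hνRT
  cases hνLT
  cases hνRP
  cases hνLP
  rfl

lemma StrongSymmLinearFunctor.ext_data [SymmLinDistCategory X] [SymmLinDistCategory Y]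
    {F G : StrongSymmLinearFunctor X Y} (h : F.toLinearFunctorData = G.toLinearFunctorData) :
    F = G := by
  obtain ⟨⟨F⟩⟩ := F
  obtain ⟨⟨G⟩⟩ := G
  dsimp only at h
  subst h
  rfl

lemma MedialLinearFunctor.ext_of_heq [SymmLinDistCategory X] [SymmLinDistCategory Y]
    [MedialStructure X] [MedialStructure Y] {F G : MedialLinearFunctor X Y}
    (h : F.toStrongSymmLinearFunctor = G.toStrongSymmLinearFunctor)
    (hmBot : HEq F.medial.mBot G.medial.mBot) (hmPar : HEq F.medial.mPar G.medial.mPar)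
    (hnTop : HEq F.medial.nTop G.medial.nTop) (hnTen : HEq F.medial.nTen G.medial.nTen) :
    F = G := by
  obtain ⟨F, ⟨⟨lax, oplax⟩⟩⟩ := F
  obtain ⟨G, ⟨⟨lax', oplax'⟩⟩⟩ := G
  dsimp only at h
  subst h
  obtain rfl : lax = lax' := by
    apply Functor.LaxMonoidal.ext
    · exact eq_of_heq hmBot
    · exact eq_of_heq hmPar
  obtain rfl : oplax = oplax' := by
    apply Functor.OplaxMonoidal.ext
    · exact eq_of_heq hnTop
    · exact eq_of_heq hnTen
  rfl

variable {Z : Type u₃} [Category.{v₃} Z] {W : Type u} [Category.{v} W]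

section

variable [SymmLinDistCategory X] [SymmLinDistCategory Y] [SymmLinDistCategory Z]
  [SymmLinDistCategory W]

namespace StrongSymmLinearFunctor

lemma id_comp (F : StrongSymmLinearFunctor X Y) : (StrongSymmLinearFunctor.id X).comp F = F := by
  apply ext_data
  refine LinearFunctorData.ext_of_heq rfl rfl (heq_of_eq ?_) (heq_of_eq ?_) (heq_of_eq ?_)
    (heq_of_eq ?_) (heq_of_eq ?_) (heq_of_eq ?_) (heq_of_eq ?_) (heq_of_eq ?_)
  all_goals first | funext A B; dsimp; simp | dsimp; simp

lemma comp_id (F : StrongSymmLinearFunctor X Y) : F.comp (StrongSymmLinearFunctor.id Y) = F := by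
  apply ext_data
  refine LinearFunctorData.ext_of_heq rfl rfl (heq_of_eq ?_) (heq_of_eq ?_) (heq_of_eq ?_)
    (heq_of_eq ?_) (heq_of_eq ?_) (heq_of_eq ?_) (heq_of_eq ?_) (heq_of_eq ?_)
  all_goals first | funext A B; dsimp; simp | dsimp; simp

lemma comp_assoc (F : StrongSymmLinearFunctor X Y) (G : StrongSymmLinearFunctor Y Z)
    (H : StrongSymmLinearFunctor Z W) : (F.comp G).comp H = F.comp (G.comp H) := by
  apply ext_data
  refine LinearFunctorData.ext_of_heq rfl rfl (heq_of_eq ?_) (heq_of_eq ?_) (heq_of_eq ?_)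
    (heq_of_eq ?_) (heq_of_eq ?_) (heq_of_eq ?_) (heq_of_eq ?_) (heq_of_eq ?_)
  all_goals first | funext A B; dsimp; simp | dsimp; simp

end StrongSymmLinearFunctor

end

namespace MedialLinearFunctor

/-- The identity medial linear functor. -/
def id (X : Type u₁) [Category.{v₁} X] [SymmLinDistCategory X] [MedialStructure X] :
    MedialLinearFunctor X X where
  toStrongSymmLinearFunctor := StrongSymmLinearFunctor.id X
  medial := MedialFunctorStructure.id X

variable [SymmLinDistCategory X] [SymmLinDistCategory Y] [SymmLinDistCategory Z]
  [SymmLinDistCategory W] [MedialStructure X] [MedialStructure Y] [MedialStructure Z]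
  [MedialStructure W]

/-- The composite of medial linear functors. -/
def comp (F : MedialLinearFunctor X Y) (G : MedialLinearFunctor Y Z) :
    MedialLinearFunctor X Z where
  toStrongSymmLinearFunctor := F.toStrongSymmLinearFunctor.comp G.toStrongSymmLinearFunctor
  medial := F.medial.comp G.medial

lemma id_comp (F : MedialLinearFunctor X Y) : (MedialLinearFunctor.id X).comp F = F := by
  refine ext_of_heq (StrongSymmLinearFunctor.id_comp _) (heq_of_eq ?_) (heq_of_eq ?_)
    (heq_of_eq ?_) (heq_of_eq ?_)
  all_goals
    first | funext A B; dsimp [comp, id, MedialFunctorStructure.comp, MedialFunctorStructure.id] | dsimp [comp, id, MedialFunctorStructure.comp, MedialFunctorStructure.id]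
    simp

lemma comp_id (F : MedialLinearFunctor X Y) : F.comp (MedialLinearFunctor.id Y) = F := by
  refine ext_of_heq (StrongSymmLinearFunctor.comp_id _) (heq_of_eq ?_) (heq_of_eq ?_)
    (heq_of_eq ?_) (heq_of_eq ?_)
  all_goals
    first | funext A B; dsimp [comp, id, MedialFunctorStructure.comp, MedialFunctorStructure.id] | dsimp [comp, id, MedialFunctorStructure.comp, MedialFunctorStructure.id]
    simp

lemma comp_assoc (F : MedialLinearFunctor X Y) (G : MedialLinearFunctor Y Z)
    (H : MedialLinearFunctor Z W) : (F.comp G).comp H = F.comp (G.comp H) := by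
  refine ext_of_heq (StrongSymmLinearFunctor.comp_assoc _ _ _) (heq_of_eq ?_) (heq_of_eq ?_)
    (heq_of_eq ?_) (heq_of_eq ?_)
  all_goals
    first | funext A B; dsimp [comp, MedialFunctorStructure.comp] | dsimp [comp, MedialFunctorStructure.comp]
    simp

end MedialLinearFunctor

end StrictLaws

/-! ## The 2-categories of cartesian and of medial linearly distributive categories -/

/-- A cartesian linearly distributive category. -/
structure CLDC where
  carrier : Type u
  [cat : Category.{v} carrier]
  [symm : SymmLinDistCategory carrier]
  [cart : CartesianStructure carrier]

attribute [instance] CLDC.cat CLDC.symm CLDC.cart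

/-- A symmetric medial linearly distributive category. -/
structure SMLDC where
  carrier : Type u
  [cat : Category.{v} carrier]
  [symm : SymmLinDistCategory carrier]
  [medial : MedialStructure carrier]

attribute [instance] SMLDC.cat SMLDC.symm SMLDC.medial

namespace CLDC

/-- 1-cells are cartesian (that is, strong symmetric) linear functors, composed in
diagrammatic order. -/
instance : CategoryStruct CLDC.{v, u} where
  Hom X Y := StrongSymmLinearFunctor X.carrier Y.carrier
  id X := StrongSymmLinearFunctor.id X.carrier
  comp F G := StrongSymmLinearFunctor.comp F G

/-- 2-cells are linear transformations. -/
instance (X Y : CLDC.{v, u}) : Category (X ⟶ Y) where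
  Hom F G := LinearTransformation F.toLinearFunctor G.toLinearFunctor
  id F := LinearTransformation.id F.toLinearFunctor
  comp α β := LinearTransformation.vcomp α β
  id_comp α := LinearTransformation.ext (Category.id_comp α.t) (Category.comp_id α.p)
  comp_id α := LinearTransformation.ext (Category.comp_id α.t) (Category.id_comp α.p)
  assoc α β γ := LinearTransformation.ext (Category.assoc α.t β.t γ.t)
    (Category.assoc γ.p β.p α.p).symm

variable {X Y Z W : CLDC.{v, u}}

lemma hom_id_comp (F : X ⟶ Y) : 𝟙 X ≫ F = F := StrongSymmLinearFunctor.id_comp F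

lemma hom_comp_id (F : X ⟶ Y) : F ≫ 𝟙 Y = F := StrongSymmLinearFunctor.comp_id F

lemma hom_comp_assoc (F : X ⟶ Y) (G : Y ⟶ Z) (H : Z ⟶ W) : (F ≫ G) ≫ H = F ≫ G ≫ H :=
  StrongSymmLinearFunctor.comp_assoc F G H

/-- Left whiskering of 2-cells. -/
def whiskerLeft (F : X ⟶ Y) {G H : Y ⟶ Z} (β : G ⟶ H) : F ≫ G ⟶ F ≫ H :=
  LinearTransformation.whiskerLeft F.toLinearFunctor β

/-- Right whiskering of 2-cells. -/
def whiskerRight {F G : X ⟶ Y} (α : F ⟶ G) (H : Y ⟶ Z) : F ≫ H ⟶ G ≫ H :=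
  LinearTransformation.whiskerRight α H.toLinearFunctor

lemma whiskerLeft_eqToHom (F : X ⟶ Y) {G H : Y ⟶ Z} (h : G = H) :
    whiskerLeft F (eqToHom h) = eqToHom (by rw [h]) := by
  subst h
  exact LinearTransformation.ext rfl rfl

lemma eqToHom_whiskerRight {F G : X ⟶ Y} (h : F = G) (H : Y ⟶ Z) :
    whiskerRight (eqToHom h) H = eqToHom (by rw [h]) := by
  subst h
  exact LinearTransformation.ext (Functor.whiskerRight_id _) (Functor.whiskerRight_id _)

lemma eq_conj {F F' G G' : X ⟶ Y} (hF : F = F') (hG : G' = G) (α : F ⟶ G) (β : F' ⟶ G')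
    (ht : HEq α.t β.t) (hp : HEq α.p β.p) : α = eqToHom hF ≫ β ≫ eqToHom hG := by
  subst hF hG
  rw [eqToHom_refl, eqToHom_refl, Category.id_comp, Category.comp_id]
  exact LinearTransformation.ext (eq_of_heq ht) (eq_of_heq hp)

lemma id_whiskerLeft_eq {F G : X ⟶ Y} (η : F ⟶ G) :
    whiskerLeft (𝟙 X) η = eqToHom (hom_id_comp F) ≫ η ≫ eqToHom (hom_id_comp G).symm :=
  eq_conj _ _ _ _ HEq.rfl HEq.rfl

lemma whiskerRight_id_eq {F G : X ⟶ Y} (η : F ⟶ G) :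
    whiskerRight η (𝟙 Y) = eqToHom (hom_comp_id F) ≫ η ≫ eqToHom (hom_comp_id G).symm :=
  eq_conj _ _ _ _ HEq.rfl HEq.rfl

lemma comp_whiskerLeft_eq (F : X ⟶ Y) (G : Y ⟶ Z) {H H' : Z ⟶ W} (η : H ⟶ H') :
    whiskerLeft (F ≫ G) η = eqToHom (hom_comp_assoc F G H) ≫
      whiskerLeft F (whiskerLeft G η) ≫ eqToHom (hom_comp_assoc F G H').symm :=
  eq_conj _ _ _ _ HEq.rfl HEq.rfl

lemma whiskerRight_comp_eq {F F' : X ⟶ Y} (η : F ⟶ F') (G : Y ⟶ Z) (H : Z ⟶ W) :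
    whiskerRight η (G ≫ H) = eqToHom (hom_comp_assoc F G H).symm ≫
      whiskerRight (whiskerRight η G) H ≫ eqToHom (hom_comp_assoc F' G H) :=
  eq_conj _ _ _ _ HEq.rfl HEq.rfl

lemma whisker_assoc_eq (F : X ⟶ Y) {G G' : Y ⟶ Z} (η : G ⟶ G') (H : Z ⟶ W) :
    whiskerRight (whiskerLeft F η) H = eqToHom (hom_comp_assoc F G H) ≫
      whiskerLeft F (whiskerRight η H) ≫ eqToHom (hom_comp_assoc F G' H).symm :=
  eq_conj _ _ _ _ HEq.rfl HEq.rfl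

lemma whisker_exchange_eq {F G : X ⟶ Y} {H K : Y ⟶ Z} (η : F ⟶ G) (θ : H ⟶ K) :
    whiskerLeft F θ ≫ whiskerRight η K = whiskerRight η H ≫ whiskerLeft G θ :=
  LinearTransformation.ext (NatTrans.ext (funext fun _ => (θ.t.naturality _).symm))
    (NatTrans.ext (funext fun _ => θ.p.naturality _))

/-- The 2-category of cartesian linearly distributive categories. -/
instance : Bicategory CLDC.{v, u} where
  whiskerLeft F _ _ β := whiskerLeft F β
  whiskerRight α H := whiskerRight α H
  associator F G H := eqToIso (hom_comp_assoc F G H)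
  leftUnitor F := eqToIso (hom_id_comp F)
  rightUnitor F := eqToIso (hom_comp_id F)
  whiskerLeft_id F G := LinearTransformation.ext rfl rfl
  whiskerLeft_comp F _ _ _ η θ := LinearTransformation.ext rfl rfl
  id_whiskerRight F G :=
    LinearTransformation.ext (Functor.whiskerRight_id _) (Functor.whiskerRight_id _)
  comp_whiskerRight η θ G :=
    LinearTransformation.ext (Functor.whiskerRight_comp _ _ _)
      (Functor.whiskerRight_comp _ _ _)
  id_whiskerLeft η := id_whiskerLeft_eq η
  comp_whiskerLeft F G _ _ η := comp_whiskerLeft_eq F G η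
  whiskerRight_id η := whiskerRight_id_eq η
  whiskerRight_comp η G H := whiskerRight_comp_eq η G H
  whisker_assoc F _ _ η H := whisker_assoc_eq F η H
  whisker_exchange η θ := whisker_exchange_eq η θ
  pentagon F G H K := by
    simp only [eqToIso.hom, whiskerLeft_eqToHom, eqToHom_whiskerRight, eqToHom_trans]
  triangle F G := by
    simp only [eqToIso.hom, whiskerLeft_eqToHom, eqToHom_whiskerRight, eqToHom_trans]

instance : Bicategory.Strict CLDC.{v, u} where
  id_comp := hom_id_comp
  comp_id := hom_comp_id
  assoc := hom_comp_assoc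
  leftUnitor_eqToIso _ := rfl
  rightUnitor_eqToIso _ := rfl
  associator_eqToIso _ _ _ := rfl

end CLDC

namespace SMLDC

/-- 1-cells are strong symmetric medial linear functors, composed in
diagrammatic order. -/
instance : CategoryStruct SMLDC.{v, u} where
  Hom X Y := MedialLinearFunctor X.carrier Y.carrier
  id X := MedialLinearFunctor.id X.carrier
  comp F G := MedialLinearFunctor.comp F G

/-- 2-cells are medial linear transformations. -/
instance (X Y : SMLDC.{v, u}) : Category (X ⟶ Y) where
  Hom F G := MedialLinearTransformation F G
  id F := ⟨LinearTransformation.id F.toLinearFunctor, IsMedialTransformation.id _⟩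
  comp α β := ⟨LinearTransformation.vcomp α.toLinearTransformation β.toLinearTransformation,
    IsMedialTransformation.vcomp α.isMedial β.isMedial⟩
  id_comp α := MedialLinearTransformation.ext (Category.id_comp α.t) (Category.comp_id α.p)
  comp_id α := MedialLinearTransformation.ext (Category.comp_id α.t) (Category.id_comp α.p)
  assoc α β γ := MedialLinearTransformation.ext (Category.assoc α.t β.t γ.t)
    (Category.assoc γ.p β.p α.p).symm

variable {X Y Z W : SMLDC.{v, u}}

lemma hom_id_comp (F : X ⟶ Y) : 𝟙 X ≫ F = F := MedialLinearFunctor.id_comp F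

lemma hom_comp_id (F : X ⟶ Y) : F ≫ 𝟙 Y = F := MedialLinearFunctor.comp_id F

lemma hom_comp_assoc (F : X ⟶ Y) (G : Y ⟶ Z) (H : Z ⟶ W) : (F ≫ G) ≫ H = F ≫ G ≫ H :=
  MedialLinearFunctor.comp_assoc F G H

/-- Left whiskering of 2-cells. -/
def whiskerLeft (F : X ⟶ Y) {G H : Y ⟶ Z} (β : G ⟶ H) : F ≫ G ⟶ F ≫ H :=
  ⟨LinearTransformation.whiskerLeft F.toLinearFunctor β.toLinearTransformation,
    IsMedialTransformation.whiskerLeft _ β.isMedial⟩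

/-- Right whiskering of 2-cells. -/
def whiskerRight {F G : X ⟶ Y} (α : F ⟶ G) (H : Y ⟶ Z) : F ≫ H ⟶ G ≫ H :=
  ⟨LinearTransformation.whiskerRight α.toLinearTransformation H.toLinearFunctor,
    IsMedialTransformation.whiskerRight α.isMedial _⟩

lemma whiskerLeft_eqToHom (F : X ⟶ Y) {G H : Y ⟶ Z} (h : G = H) :
    whiskerLeft F (eqToHom h) = eqToHom (by rw [h]) := by
  subst h
  exact MedialLinearTransformation.ext rfl rfl

lemma eqToHom_whiskerRight {F G : X ⟶ Y} (h : F = G) (H : Y ⟶ Z) :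
    whiskerRight (eqToHom h) H = eqToHom (by rw [h]) := by
  subst h
  exact MedialLinearTransformation.ext (Functor.whiskerRight_id _) (Functor.whiskerRight_id _)

lemma eq_conj {F F' G G' : X ⟶ Y} (hF : F = F') (hG : G' = G) (α : F ⟶ G) (β : F' ⟶ G')
    (ht : HEq α.t β.t) (hp : HEq α.p β.p) : α = eqToHom hF ≫ β ≫ eqToHom hG := by
  subst hF hG
  rw [eqToHom_refl, eqToHom_refl, Category.id_comp, Category.comp_id]
  exact MedialLinearTransformation.ext (eq_of_heq ht) (eq_of_heq hp)

lemma id_whiskerLeft_eq {F G : X ⟶ Y} (η : F ⟶ G) :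
    whiskerLeft (𝟙 X) η = eqToHom (hom_id_comp F) ≫ η ≫ eqToHom (hom_id_comp G).symm :=
  eq_conj _ _ _ _ HEq.rfl HEq.rfl

lemma whiskerRight_id_eq {F G : X ⟶ Y} (η : F ⟶ G) :
    whiskerRight η (𝟙 Y) = eqToHom (hom_comp_id F) ≫ η ≫ eqToHom (hom_comp_id G).symm :=
  eq_conj _ _ _ _ HEq.rfl HEq.rfl

lemma comp_whiskerLeft_eq (F : X ⟶ Y) (G : Y ⟶ Z) {H H' : Z ⟶ W} (η : H ⟶ H') :
    whiskerLeft (F ≫ G) η = eqToHom (hom_comp_assoc F G H) ≫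
      whiskerLeft F (whiskerLeft G η) ≫ eqToHom (hom_comp_assoc F G H').symm :=
  eq_conj _ _ _ _ HEq.rfl HEq.rfl

lemma whiskerRight_comp_eq {F F' : X ⟶ Y} (η : F ⟶ F') (G : Y ⟶ Z) (H : Z ⟶ W) :
    whiskerRight η (G ≫ H) = eqToHom (hom_comp_assoc F G H).symm ≫
      whiskerRight (whiskerRight η G) H ≫ eqToHom (hom_comp_assoc F' G H) :=
  eq_conj _ _ _ _ HEq.rfl HEq.rfl

lemma whisker_assoc_eq (F : X ⟶ Y) {G G' : Y ⟶ Z} (η : G ⟶ G') (H : Z ⟶ W) :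
    whiskerRight (whiskerLeft F η) H = eqToHom (hom_comp_assoc F G H) ≫
      whiskerLeft F (whiskerRight η H) ≫ eqToHom (hom_comp_assoc F G' H).symm :=
  eq_conj _ _ _ _ HEq.rfl HEq.rfl

lemma whisker_exchange_eq {F G : X ⟶ Y} {H K : Y ⟶ Z} (η : F ⟶ G) (θ : H ⟶ K) :
    whiskerLeft F θ ≫ whiskerRight η K = whiskerRight η H ≫ whiskerLeft G θ :=
  MedialLinearTransformation.ext (NatTrans.ext (funext fun _ => (θ.t.naturality _).symm))
    (NatTrans.ext (funext fun _ => θ.p.naturality _))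

/-- The 2-category of symmetric medial linearly distributive categories. -/
instance : Bicategory SMLDC.{v, u} where
  whiskerLeft F _ _ β := whiskerLeft F β
  whiskerRight α H := whiskerRight α H
  associator F G H := eqToIso (hom_comp_assoc F G H)
  leftUnitor F := eqToIso (hom_id_comp F)
  rightUnitor F := eqToIso (hom_comp_id F)
  whiskerLeft_id F G := MedialLinearTransformation.ext rfl rfl
  whiskerLeft_comp F _ _ _ η θ := MedialLinearTransformation.ext rfl rfl
  id_whiskerRight F G :=
    MedialLinearTransformation.ext (Functor.whiskerRight_id _) (Functor.whiskerRight_id _)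
  comp_whiskerRight η θ G :=
    MedialLinearTransformation.ext (Functor.whiskerRight_comp _ _ _)
      (Functor.whiskerRight_comp _ _ _)
  id_whiskerLeft η := id_whiskerLeft_eq η
  comp_whiskerLeft F G _ _ η := comp_whiskerLeft_eq F G η
  whiskerRight_id η := whiskerRight_id_eq η
  whiskerRight_comp η G H := whiskerRight_comp_eq η G H
  whisker_assoc F _ _ η H := whisker_assoc_eq F η H
  whisker_exchange η θ := whisker_exchange_eq η θ
  pentagon F G H K := by
    simp only [eqToIso.hom, whiskerLeft_eqToHom, eqToHom_whiskerRight, eqToHom_trans]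
  triangle F G := by
    simp only [eqToIso.hom, whiskerLeft_eqToHom, eqToHom_whiskerRight, eqToHom_trans]

instance : Bicategory.Strict SMLDC.{v, u} where
  id_comp := hom_id_comp
  comp_id := hom_comp_id
  assoc := hom_comp_assoc
  leftUnitor_eqToIso _ := rfl
  rightUnitor_eqToIso _ := rfl
  associator_eqToIso _ _ _ := rfl

end SMLDC

/-! ## The inclusion -/

/-- A medial structure on a cartesian linearly distributive category is the canonical one:
`Δ_⊥ = b = ⟨1, 1⟩`, `∇_⊤ = t = [1, 1]`, `m = t_⊥ = b_⊤` and
`μ = ⟨π₀ + π₀, π₁ + π₁⟩ = [ι₀ × ι₀, ι₁ × ι₁]`. -/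
structure IsCanonicalMedialStructure {X : Type u} [Category.{v} X] [SymmLinDistCategory X]
    [CartesianStructure X] (M : MedialStructure X) : Prop where
  Δbot_eq : M.Δbot = fromBot (⊥ₗ ⊠ ⊥ₗ)
  Δbot_fst : M.Δbot ≫ prodFst ⊥ₗ ⊥ₗ = 𝟙 ⊥ₗ
  Δbot_snd : M.Δbot ≫ prodSnd ⊥ₗ ⊥ₗ = 𝟙 ⊥ₗ
  nablaTop_eq : M.nablaTop = toTop ((⊤ₗ : X) ⊞ ⊤ₗ)
  inl_nablaTop : coprodInl ⊤ₗ ⊤ₗ ≫ M.nablaTop = 𝟙 ⊤ₗ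
  inr_nablaTop : coprodInr ⊤ₗ ⊤ₗ ≫ M.nablaTop = 𝟙 ⊤ₗ
  mix_eq_toTop : M.mix = toTop ⊥ₗ
  mix_eq_fromBot : M.mix = fromBot ⊤ₗ
  med_fst (A B C D : X) : M.med A B C D ≫ prodFst (A ⊞ C) (B ⊞ D) = prodFst A B ⊞ₕ prodFst C D
  med_snd (A B C D : X) : M.med A B C D ≫ prodSnd (A ⊞ C) (B ⊞ D) = prodSnd A B ⊞ₕ prodSnd C D
  inl_med (A B C D : X) :
    coprodInl (A ⊠ B) (C ⊠ D) ≫ M.med A B C D = coprodInl A C ⊠ₕ coprodInl B D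
  inr_med (A B C D : X) :
    coprodInr (A ⊠ B) (C ⊠ D) ≫ M.med A B C D = coprodInr A C ⊠ₕ coprodInr B D

/-- A medial structure on a cartesian linear functor `F` is the canonical one: `m_⊥ = b` and
`m_⊕ = [F_⊗ ι₀, F_⊗ ι₁]` on `F_⊗`, and `n_⊤ = t` and `n_⊗ = ⟨F_⊕ π₀, F_⊕ π₁⟩` on `F_⊕`. -/
structure IsCanonicalMedialFunctor {X : Type u₁} [Category.{v₁} X] {Y : Type u₂}
    [Category.{v₂} Y] [SymmLinDistCategory X] [SymmLinDistCategory Y] [CartesianStructure X]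
    [CartesianStructure Y] {F : StrongSymmLinearFunctor X Y} (M : MedialFunctorData F) : Prop where
  mBot_eq : M.mBot = fromBot (F.T.obj ⊥ₗ)
  inl_mPar (A B : X) :
    coprodInl (F.T.obj A) (F.T.obj B) ≫ M.mPar A B = F.T.map (coprodInl A B)
  inr_mPar (A B : X) :
    coprodInr (F.T.obj A) (F.T.obj B) ≫ M.mPar A B = F.T.map (coprodInr A B)
  nTop_eq : M.nTop = toTop (F.P.obj ⊤ₗ)
  nTen_fst (A B : X) :
    M.nTen A B ≫ prodFst (F.P.obj A) (F.P.obj B) = F.P.map (prodFst A B)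
  nTen_snd (A B : X) :
    M.nTen A B ≫ prodSnd (F.P.obj A) (F.P.obj B) = F.P.map (prodSnd A B)

/-- The assignment on 0-cells, 1-cells and 2-cells which leaves all the data of cartesian linearly
distributive categories, cartesian linear functors and linear transformations unchanged and equips
them with the given medial structures. -/
def inclusionStruct (med : ∀ X : CLDC.{v, u}, MedialStructure X.carrier)
    (medF : ∀ {X Y : CLDC.{v, u}} (F : X ⟶ Y),
      @MedialFunctorStructure X.carrier _ Y.carrier _ _ _ (med X) (med Y) F)
    (medT : ∀ {X Y : CLDC.{v, u}} {F G : X ⟶ Y} (α : F ⟶ G),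
      IsMedialTransformation (medF F).toMedialFunctorData (medF G).toMedialFunctorData α) :
    PrelaxFunctorStruct CLDC.{v, u} SMLDC.{v, u} where
  obj X := @SMLDC.mk X.carrier _ _ (med X)
  map {X Y} F :=
    @MedialLinearFunctor.mk X.carrier _ Y.carrier _ _ _ (med X) (med Y) F (medF F)
  map₂ {X Y F G} α :=
    @MedialLinearTransformation.mk X.carrier _ Y.carrier _ _ _ (med X) (med Y)
      (@MedialLinearFunctor.mk X.carrier _ Y.carrier _ _ _ (med X) (med Y) F (medF F))
      (@MedialLinearFunctor.mk X.carrier _ Y.carrier _ _ _ (med X) (med Y) G (medF G))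
      α (medT α)

end LinDist

/-!
A map out of `A ⊕ B` or into `A ⊗ B` is determined by its two components, and by naturality and the
unit laws the distributivities are compatible with projections and injections:
`(1 ⊗ ι₀); δ^L = ι₀` and `δ^L; (π₁ ⊕ 1) = π₁`, and symmetrically for `δ^R`. The coherence laws of
`μ` can therefore be checked on components. For the mix law, the coherence between the two
distributivities forces any two maps into `⊥` to agree; in particular `π₀ = π₁ : ⊥ ⊗ ⊥ ⟶ ⊥`, and
this identifies the two mix maps.

For a cartesian linear functor `F`, the object `F_⊗ ⊤` is terminal and `F_⊕ ⊥` is initial, and the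
comparison maps and linear strengths commute with projections and injections, so that the laws of a
medial functor also hold componentwise. A functor between categories with finite coproducts
(products) is monoidal (comonoidal) for them in exactly one way. Hence the medial structure of `F`
is unique, every linear transformation respects it, and the inclusion preserves identities and
composites strictly.
-/

namespace LinDist

open LinDistCategory

/-! ## Products and coproducts -/

section CartesianMonoidalCategory

open MonoidalCategory CartesianMonoidalCategory

variable {C : Type u} [Category.{v} C] [CartesianMonoidalCategory C]

lemma tensorHom_eq_lift {A A' B B' : C} (f : A ⟶ A') (g : B ⟶ B') :
    f ⊗ₘ g = lift (fst A B ≫ f) (snd A B ≫ g) := by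
  simp

lemma whiskerLeft_eq_lift (A : C) {B B' : C} (g : B ⟶ B') :
    A ◁ g = lift (fst A B) (snd A B ≫ g) := by
  ext <;> simp

lemma whiskerRight_eq_lift {A A' : C} (f : A ⟶ A') (B : C) :
    f ▷ B = lift (fst A B ≫ f) (snd A B) := by
  ext <;> simp

lemma associator_hom_eq_lift (A B D : C) :
    (α_ A B D).hom =
      lift (fst (A ⊗ B) D ≫ fst A B) (lift (fst (A ⊗ B) D ≫ snd A B) (snd (A ⊗ B) D)) := by
  ext <;> simp

lemma associator_inv_eq_lift (A B D : C) :
    (α_ A B D).inv =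
      lift (lift (fst A (B ⊗ D)) (snd A (B ⊗ D) ≫ fst B D)) (snd A (B ⊗ D) ≫ snd B D) := by
  ext <;> simp

lemma leftUnitor_inv_eq_lift (A : C) : (λ_ A).inv = lift (toUnit A) (𝟙 A) := by
  ext; simp

lemma rightUnitor_inv_eq_lift (A : C) : (ρ_ A).inv = lift (𝟙 A) (toUnit A) := by
  ext; simp

lemma braiding_hom_eq_lift [BraidedCategory C] (A B : C) :
    (β_ A B).hom = lift (snd A B) (fst A B) := by
  ext <;> simp

end CartesianMonoidalCategory

section Cartesian

variable {X : Type u} [Category.{v} X] [SymmLinDistCategory X] [CartesianStructure X]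

/-- The tensor product as one of Mathlib's cartesian monoidal structures. -/
abbrev tensorCartesian : CartesianMonoidalCategory X where
  toMonoidalCategory := TwoMonoidal.tensor
  isTerminalTensorUnit := CartesianStructure.topTerminal
  fst := prodFst
  snd := prodSnd
  fst_def _ _ := rfl
  snd_def _ _ := rfl
  tensorProductIsBinaryProduct := CartesianStructure.isProduct

/-- The par as a cartesian monoidal structure on the opposite category, along which facts about
coproducts are read off from those about products. -/
abbrev parCocartesian : CartesianMonoidalCategory Xᵒᵖ where
  toMonoidalCategory := @monoidalCategoryOp X _ TwoMonoidal.par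
  isTerminalTensorUnit := terminalOpOfInitial CartesianStructure.botInitial
  fst A B := (coprodInl A.unop B.unop).op
  snd A B := (coprodInr A.unop B.unop).op
  fst_def _ _ := rfl
  snd_def _ _ := rfl
  tensorProductIsBinaryProduct A B :=
    BinaryCofan.IsColimit.op (CartesianStructure.isCoproduct A.unop B.unop)

lemma toTop_ext {A : X} (f g : A ⟶ ⊤ₗ) : f = g := CartesianStructure.topTerminal.hom_ext f g

lemma fromBot_ext {A : X} (f g : ⊥ₗ ⟶ A) : f = g := CartesianStructure.botInitial.hom_ext f g

section Tensor

attribute [local instance] tensorCartesian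

/-- The pairing `⟨f, g⟩` of two maps into a product. -/
def prodLift {Z A B : X} (f : Z ⟶ A) (g : Z ⟶ B) : Z ⟶ A ⊠ B :=
  CartesianMonoidalCategory.lift f g

@[simp]
lemma prodLift_fst {Z A B : X} (f : Z ⟶ A) (g : Z ⟶ B) : prodLift f g ≫ prodFst A B = f :=
  CartesianMonoidalCategory.lift_fst f g

@[simp]
lemma prodLift_fst_assoc {Z A B W : X} (f : Z ⟶ A) (g : Z ⟶ B) (h : A ⟶ W) :
    prodLift f g ≫ prodFst A B ≫ h = f ≫ h := by
  rw [reassoc_of% prodLift_fst]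

@[simp]
lemma prodLift_snd {Z A B : X} (f : Z ⟶ A) (g : Z ⟶ B) : prodLift f g ≫ prodSnd A B = g :=
  CartesianMonoidalCategory.lift_snd f g

@[simp]
lemma prodLift_snd_assoc {Z A B W : X} (f : Z ⟶ A) (g : Z ⟶ B) (h : B ⟶ W) :
    prodLift f g ≫ prodSnd A B ≫ h = g ≫ h := by
  rw [reassoc_of% prodLift_snd]

lemma prod_ext {Z A B : X} {f g : Z ⟶ A ⊠ B} (h₀ : f ≫ prodFst A B = g ≫ prodFst A B)
    (h₁ : f ≫ prodSnd A B = g ≫ prodSnd A B) : f = g :=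
  CartesianMonoidalCategory.hom_ext f g h₀ h₁

lemma tensorHom_eq {A A' B B' : X} (f : A ⟶ A') (g : B ⟶ B') :
    (f ⊠ₕ g) = prodLift (prodFst A B ≫ f) (prodSnd A B ≫ g) :=
  tensorHom_eq_lift f g

lemma tensorLeft_eq (A : X) {B B' : X} (g : B ⟶ B') :
    (A ◁⊠ g) = prodLift (prodFst A B) (prodSnd A B ≫ g) :=
  whiskerLeft_eq_lift A g

lemma tensorRight_eq {A A' : X} (f : A ⟶ A') (B : X) :
    (f ▷⊠ B) = prodLift (prodFst A B ≫ f) (prodSnd A B) :=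
  whiskerRight_eq_lift f B

lemma tensorAssociator_hom (A B C : X) :
    (α⊠ A B C).hom = prodLift (prodFst (A ⊠ B) C ≫ prodFst A B)
      (prodLift (prodFst (A ⊠ B) C ≫ prodSnd A B) (prodSnd (A ⊠ B) C)) :=
  associator_hom_eq_lift A B C

lemma tensorAssociator_inv (A B C : X) :
    (α⊠ A B C).inv = prodLift (prodLift (prodFst A (B ⊠ C)) (prodSnd A (B ⊠ C) ≫ prodFst B C))
      (prodSnd A (B ⊠ C) ≫ prodSnd B C) :=
  associator_inv_eq_lift A B C

lemma tensorLeftUnitor_inv (A : X) : (λ⊠ A).inv = prodLift (toTop A) (𝟙 A) :=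
  leftUnitor_inv_eq_lift A

lemma tensorRightUnitor_inv (A : X) : (ρ⊠ A).inv = prodLift (𝟙 A) (toTop A) :=
  rightUnitor_inv_eq_lift A

lemma tensorBraiding_hom (A B : X) :
    (β⊠ A B).hom = prodLift (prodSnd A B) (prodFst A B) :=
  let : BraidedCategory X := SymmLinDistCategory.tensorSymm.toBraidedCategory
  braiding_hom_eq_lift A B

end Tensor

section Par

attribute [local instance] parCocartesian

/-- The copairing `[f, g]` of two maps out of a coproduct. -/
def coprodDesc {Z A B : X} (f : A ⟶ Z) (g : B ⟶ Z) : A ⊞ B ⟶ Z :=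
  (CartesianMonoidalCategory.lift f.op g.op).unop

@[simp]
lemma inl_coprodDesc {Z A B : X} (f : A ⟶ Z) (g : B ⟶ Z) :
    coprodInl A B ≫ coprodDesc f g = f :=
  congrArg Quiver.Hom.unop (CartesianMonoidalCategory.lift_fst f.op g.op)

@[simp]
lemma inl_coprodDesc_assoc {Z A B W : X} (f : A ⟶ Z) (g : B ⟶ Z) (h : Z ⟶ W) :
    coprodInl A B ≫ coprodDesc f g ≫ h = f ≫ h := by
  rw [reassoc_of% inl_coprodDesc]

@[simp]
lemma inr_coprodDesc {Z A B : X} (f : A ⟶ Z) (g : B ⟶ Z) :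
    coprodInr A B ≫ coprodDesc f g = g :=
  congrArg Quiver.Hom.unop (CartesianMonoidalCategory.lift_snd f.op g.op)

@[simp]
lemma inr_coprodDesc_assoc {Z A B W : X} (f : A ⟶ Z) (g : B ⟶ Z) (h : Z ⟶ W) :
    coprodInr A B ≫ coprodDesc f g ≫ h = g ≫ h := by
  rw [reassoc_of% inr_coprodDesc]

lemma coprod_ext {Z A B : X} {f g : A ⊞ B ⟶ Z} (h₀ : coprodInl A B ≫ f = coprodInl A B ≫ g)
    (h₁ : coprodInr A B ≫ f = coprodInr A B ≫ g) : f = g :=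
  Quiver.Hom.op_inj (CartesianMonoidalCategory.hom_ext f.op g.op
    (congrArg Quiver.Hom.op h₀) (congrArg Quiver.Hom.op h₁))

lemma parHom_eq {A A' B B' : X} (f : A ⟶ A') (g : B ⟶ B') :
    (f ⊞ₕ g) = coprodDesc (f ≫ coprodInl A' B') (g ≫ coprodInr A' B') :=
  congrArg Quiver.Hom.unop (tensorHom_eq_lift f.op g.op)

lemma parLeft_eq (A : X) {B B' : X} (g : B ⟶ B') :
    (A ◁⊞ g) = coprodDesc (coprodInl A B') (g ≫ coprodInr A B') :=
  congrArg Quiver.Hom.unop (whiskerLeft_eq_lift (Opposite.op A) g.op)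

lemma parRight_eq {A A' : X} (f : A ⟶ A') (B : X) :
    (f ▷⊞ B) = coprodDesc (f ≫ coprodInl A' B) (coprodInr A' B) :=
  congrArg Quiver.Hom.unop (whiskerRight_eq_lift f.op (Opposite.op B))

lemma parAssociator_hom (A B C : X) :
    (α⊞ A B C).hom = coprodDesc
      (coprodDesc (coprodInl A (B ⊞ C)) (coprodInl B C ≫ coprodInr A (B ⊞ C)))
      (coprodInr B C ≫ coprodInr A (B ⊞ C)) :=
  congrArg Quiver.Hom.unop
    (associator_inv_eq_lift (Opposite.op A) (Opposite.op B) (Opposite.op C))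

lemma parAssociator_inv (A B C : X) :
    (α⊞ A B C).inv = coprodDesc (coprodInl A B ≫ coprodInl (A ⊞ B) C)
      (coprodDesc (coprodInr A B ≫ coprodInl (A ⊞ B) C) (coprodInr (A ⊞ B) C)) :=
  congrArg Quiver.Hom.unop
    (associator_hom_eq_lift (Opposite.op A) (Opposite.op B) (Opposite.op C))

lemma parLeftUnitor_hom (A : X) : (λ⊞ A).hom = coprodDesc (fromBot A) (𝟙 A) :=
  congrArg Quiver.Hom.unop (leftUnitor_inv_eq_lift (Opposite.op A))

lemma parLeftUnitor_inv (A : X) : (λ⊞ A).inv = coprodInr ⊥ₗ A :=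
  congrArg Quiver.Hom.unop (CartesianMonoidalCategory.leftUnitor_hom (Opposite.op A))

lemma parRightUnitor_hom (A : X) : (ρ⊞ A).hom = coprodDesc (𝟙 A) (fromBot A) :=
  congrArg Quiver.Hom.unop (rightUnitor_inv_eq_lift (Opposite.op A))

lemma parRightUnitor_inv (A : X) : (ρ⊞ A).inv = coprodInl A ⊥ₗ :=
  congrArg Quiver.Hom.unop (CartesianMonoidalCategory.rightUnitor_hom (Opposite.op A))

lemma parBraiding_hom (A B : X) :
    (β⊞ A B).hom = coprodDesc (coprodInr B A) (coprodInl B A) :=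
  let : BraidedCategory Xᵒᵖ := @CategoryTheory.instBraidedCategoryOpposite X _ TwoMonoidal.par
    SymmLinDistCategory.parSymm.toBraidedCategory
  congrArg Quiver.Hom.unop (braiding_hom_eq_lift (Opposite.op B) (Opposite.op A))

end Par

end Cartesian

attribute [local simp] tensorHom_eq tensorLeft_eq tensorRight_eq tensorAssociator_hom
  tensorAssociator_inv tensorLeftUnitor_inv tensorRightUnitor_inv tensorBraiding_hom parHom_eq
  parLeft_eq parRight_eq parAssociator_hom parAssociator_inv parLeftUnitor_hom parLeftUnitor_inv
  parRightUnitor_hom parRightUnitor_inv parBraiding_hom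

/-! ## Distributivities, projections and injections -/

section Distributivities

variable {X : Type u} [Category.{v} X] [LinDistCategory X]

lemma δL_natural_left {A A' : X} (f : A ⟶ A') (B C : X) :
    (f ▷⊠ (B ⊞ C)) ≫ δL A' B C = δL A B C ≫ ((f ▷⊠ B) ▷⊞ C) := by
  simpa only [MonoidalCategory.tensorHom_id, MonoidalCategory.id_whiskerRight] using
    δL_natural f (𝟙 B) (𝟙 C)

lemma δL_natural_middle (A : X) {B B' : X} (g : B ⟶ B') (C : X) :
    (A ◁⊠ (g ▷⊞ C)) ≫ δL A B' C = δL A B C ≫ ((A ◁⊠ g) ▷⊞ C) := by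
  simpa only [MonoidalCategory.tensorHom_id, MonoidalCategory.id_tensorHom] using
    δL_natural (𝟙 A) g (𝟙 C)

lemma δL_natural_right (A B : X) {C C' : X} (h : C ⟶ C') :
    (A ◁⊠ (B ◁⊞ h)) ≫ δL A B C' = δL A B C ≫ ((A ⊠ B) ◁⊞ h) := by
  simpa only [MonoidalCategory.id_tensorHom, MonoidalCategory.whiskerLeft_id] using
    δL_natural (𝟙 A) (𝟙 B) h

lemma δR_natural_left {A A' : X} (f : A ⟶ A') (B C : X) :
    ((f ▷⊞ B) ▷⊠ C) ≫ δR A' B C = δR A B C ≫ (f ▷⊞ (B ⊠ C)) := by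
  simpa only [MonoidalCategory.tensorHom_id, MonoidalCategory.id_whiskerRight] using
    δR_natural f (𝟙 B) (𝟙 C)

lemma δR_natural_middle (A : X) {B B' : X} (g : B ⟶ B') (C : X) :
    ((A ◁⊞ g) ▷⊠ C) ≫ δR A B' C = δR A B C ≫ (A ◁⊞ (g ▷⊠ C)) := by
  simpa only [MonoidalCategory.tensorHom_id, MonoidalCategory.id_tensorHom] using
    δR_natural (𝟙 A) g (𝟙 C)

lemma δR_natural_right (A B : X) {C C' : X} (h : C ⟶ C') :
    ((A ⊞ B) ◁⊠ h) ≫ δR A B C' = δR A B C ≫ (A ◁⊞ (B ◁⊠ h)) := by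
  simpa only [MonoidalCategory.id_tensorHom, MonoidalCategory.whiskerLeft_id] using
    δR_natural (𝟙 A) (𝟙 B) h

lemma δL_leftUnitor_hom (A B : X) :
    δL ⊤ₗ A B ≫ ((λ⊠ A).hom ▷⊞ B) = (λ⊠ (A ⊞ B)).hom := by
  rw [(Iso.inv_comp_eq _).1 (leftUnit_δL A B), Category.assoc,
    @MonoidalCategory.inv_hom_whiskerRight, Category.comp_id]

lemma δR_rightUnitor_hom (A B : X) :
    δR A B ⊤ₗ ≫ (A ◁⊞ (ρ⊠ B).hom) = (ρ⊠ (A ⊞ B)).hom := by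
  rw [(Iso.inv_comp_eq _).1 (rightUnit_δR A B), Category.assoc,
    @MonoidalCategory.whiskerLeft_inv_hom, Category.comp_id]

lemma rightUnitor_inv_δL (A B : X) :
    (A ◁⊠ (ρ⊞ B).inv) ≫ δL A B ⊥ₗ = (ρ⊞ (A ⊠ B)).inv := by
  rw [(Iso.eq_comp_inv _).2 (δL_rightUnit A B), @MonoidalCategory.whiskerLeft_inv_hom_assoc]

lemma leftUnitor_inv_δR (A B : X) :
    ((λ⊞ A).inv ▷⊠ B) ≫ δR ⊥ₗ A B = (λ⊞ (A ⊠ B)).inv := by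
  rw [(Iso.eq_comp_inv _).2 (δR_leftUnit A B), @MonoidalCategory.inv_hom_whiskerRight_assoc]

end Distributivities

section Medial

variable {X : Type u} [Category.{v} X] [SymmLinDistCategory X] [CartesianStructure X]

lemma δL_snd (A B C : X) : δL A B C ≫ (prodSnd A B ▷⊞ C) = prodSnd A (B ⊞ C) := by
  rw [prodSnd, prodSnd, @MonoidalCategory.comp_whiskerRight, ← reassoc_of% δL_natural_left,
    δL_leftUnitor_hom]

lemma δR_fst (A B C : X) : δR A B C ≫ (A ◁⊞ prodFst B C) = prodFst (A ⊞ B) C := by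
  rw [prodFst, prodFst, @MonoidalCategory.whiskerLeft_comp, ← reassoc_of% δR_natural_right,
    δR_rightUnitor_hom]

lemma inl_δL (A B C : X) : (A ◁⊠ coprodInl B C) ≫ δL A B C = coprodInl (A ⊠ B) C := by
  rw [coprodInl, coprodInl, @MonoidalCategory.whiskerLeft_comp, Category.assoc, δL_natural_right,
    reassoc_of% rightUnitor_inv_δL]

lemma inr_δR (A B C : X) : (coprodInr A B ▷⊠ C) ≫ δR A B C = coprodInr A (B ⊠ C) := by
  rw [coprodInr, coprodInr, @MonoidalCategory.comp_whiskerRight, Category.assoc, δR_natural_left,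
    reassoc_of% leftUnitor_inv_δR]

lemma δR_coprodDesc_snd {A : X} (f : A ⟶ ⊥ₗ) (B C : X) :
    δR A B C ≫ coprodDesc (f ≫ fromBot C) (prodSnd B C) = prodSnd (A ⊞ B) C := by
  have h : coprodDesc (f ≫ fromBot C) (prodSnd B C) =
      (f ▷⊞ (B ⊠ C)) ≫ (λ⊞ (B ⊠ C)).hom ≫ prodSnd B C :=
    coprod_ext (by simp [fromBot_ext (fromBot C) (fromBot (B ⊠ C) ≫ prodSnd B C)]) (by simp)
  rw [h, ← reassoc_of% δR_natural_left, reassoc_of% δR_leftUnit]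
  simp

lemma δL_coprodDesc_fst {C : X} (f : C ⟶ ⊥ₗ) (A B : X) :
    δL A B C ≫ coprodDesc (prodFst A B) (f ≫ fromBot A) = prodFst A (B ⊞ C) := by
  have h : coprodDesc (prodFst A B) (f ≫ fromBot A) =
      ((A ⊠ B) ◁⊞ f) ≫ (ρ⊞ (A ⊠ B)).hom ≫ prodFst A B :=
    coprod_ext (by simp) (by simp [fromBot_ext (fromBot A) (fromBot (A ⊠ B) ≫ prodFst A B)])
  rw [h, ← reassoc_of% δL_natural_right, reassoc_of% δL_rightUnit]
  simp

lemma toBot_ext {A : X} (f g : A ⟶ ⊥ₗ) : f = g := by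
  -- The two composites of distributivities `(⊥ ⊗ (⊥ ⊕ ⊥)) ⊗ ⊥ ⟶ (⊥ ⊗ ⊥) ⊕ (⊥ ⊗ ⊥)` agree, but
  -- followed by `[π₀, π₁]` one is the last projection and the other the first.
  have h := δL_δR_tensor ⊥ₗ ⊥ₗ ⊥ₗ (⊥ₗ : X) =≫ coprodDesc (prodFst ⊥ₗ ⊥ₗ) (prodSnd ⊥ₗ ⊥ₗ)
  have hR := δR_coprodDesc_snd (prodFst ⊥ₗ ⊥ₗ) ⊥ₗ (⊥ₗ : X)
  have hL := δL_coprodDesc_fst (prodSnd ⊥ₗ ⊥ₗ) ⊥ₗ (⊥ₗ : X)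
  rw [fromBot_ext (fromBot ⊥ₗ) (𝟙 (⊥ₗ : X)), Category.comp_id] at hR hL
  rw [Category.assoc, Category.assoc, Category.assoc, hR, hL] at h
  simpa using (prodLift (prodLift f (f ≫ coprodInl ⊥ₗ ⊥ₗ)) g ≫= h).symm

lemma δL_fst_eq_δR_snd (A B : X) :
    δL (A ⊞ ⊥ₗ) ⊥ₗ B ≫ (prodFst (A ⊞ ⊥ₗ) ⊥ₗ ▷⊞ B) =
      δR A ⊥ₗ (⊥ₗ ⊞ B) ≫ (A ◁⊞ prodSnd ⊥ₗ (⊥ₗ ⊞ B)) ≫ (α⊞ A ⊥ₗ B).inv := by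
  have h := δL_δR_par A ⊥ₗ ⊥ₗ B =≫ ((A ◁⊞ prodFst ⊥ₗ ⊥ₗ) ▷⊞ B)
  rw [Category.assoc, ← @MonoidalCategory.comp_whiskerRight, δR_fst] at h
  rw [h, Category.assoc, Category.assoc, ← @MonoidalCategory.associator_inv_naturality_middle,
    toBot_ext (prodFst ⊥ₗ ⊥ₗ) (prodSnd ⊥ₗ (⊥ₗ : X)), ← @MonoidalCategory.whiskerLeft_comp_assoc,
    δL_snd]

lemma inr_δL_fst_eq_inl_δR_snd (A B : X) :
    (A ◁⊠ coprodInr ⊥ₗ B) ≫ δL A ⊥ₗ B ≫ (prodFst A ⊥ₗ ▷⊞ B) =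
      (coprodInl A ⊥ₗ ▷⊠ B) ≫ δR A ⊥ₗ B ≫ (A ◁⊞ prodSnd ⊥ₗ B) := by
  have hL : (A ◁⊠ coprodInr ⊥ₗ B) ≫ δL A ⊥ₗ B ≫ (prodFst A ⊥ₗ ▷⊞ B) =
      (coprodInl A ⊥ₗ ⊠ₕ coprodInr ⊥ₗ B) ≫ δL (A ⊞ ⊥ₗ) ⊥ₗ B ≫
        (prodFst (A ⊞ ⊥ₗ) ⊥ₗ ▷⊞ B) ≫ ((ρ⊞ A).hom ▷⊞ B) := by
    rw [@MonoidalCategory.tensorHom_def', Category.assoc, reassoc_of% δL_natural_left]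
    simp only [← MonoidalCategory.comp_whiskerRight]
    simp
  have hR : (coprodInl A ⊥ₗ ▷⊠ B) ≫ δR A ⊥ₗ B ≫ (A ◁⊞ prodSnd ⊥ₗ B) =
      (coprodInl A ⊥ₗ ⊠ₕ coprodInr ⊥ₗ B) ≫ δR A ⊥ₗ (⊥ₗ ⊞ B) ≫
        (A ◁⊞ prodSnd ⊥ₗ (⊥ₗ ⊞ B)) ≫ (A ◁⊞ (λ⊞ B).hom) := by
    rw [@MonoidalCategory.tensorHom_def, Category.assoc, reassoc_of% δR_natural_right]
    simp only [← MonoidalCategory.whiskerLeft_comp]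
    simp
  rw [hL, hR, reassoc_of% δL_fst_eq_δR_snd, @MonoidalCategory.triangle_assoc_comp_right]

lemma toTop_mix_law (A B : X) :
    (A ◁⊠ (λ⊞ B).inv) ≫ (A ◁⊠ (toTop ⊥ₗ ▷⊞ B)) ≫ δL A ⊤ₗ B ≫ ((ρ⊠ A).hom ▷⊞ B) =
      ((ρ⊞ A).inv ▷⊠ B) ≫ ((A ◁⊞ toTop ⊥ₗ) ▷⊠ B) ≫ δR A ⊤ₗ B ≫ (A ◁⊞ (λ⊠ B).hom) := by
  rw [reassoc_of% δL_natural_middle, reassoc_of% δR_natural_middle,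
    ← @MonoidalCategory.comp_whiskerRight, ← @MonoidalCategory.whiskerLeft_comp, ← prodFst,
    ← prodSnd, parLeftUnitor_inv, parRightUnitor_inv, inr_δL_fst_eq_inl_δR_snd]

/-! ## The canonical medial map -/

/-- The canonical medial map `⟨π₀ + π₀, π₁ + π₁⟩`. -/
def medMap (A B C D : X) : (A ⊠ B) ⊞ (C ⊠ D) ⟶ (A ⊞ C) ⊠ (B ⊞ D) :=
  prodLift (prodFst A B ⊞ₕ prodFst C D) (prodSnd A B ⊞ₕ prodSnd C D)

lemma medMap_fst (A B C D : X) :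
    medMap A B C D ≫ prodFst (A ⊞ C) (B ⊞ D) = (prodFst A B ⊞ₕ prodFst C D) :=
  prodLift_fst _ _

lemma medMap_snd (A B C D : X) :
    medMap A B C D ≫ prodSnd (A ⊞ C) (B ⊞ D) = (prodSnd A B ⊞ₕ prodSnd C D) :=
  prodLift_snd _ _

lemma inl_medMap (A B C D : X) :
    coprodInl (A ⊠ B) (C ⊠ D) ≫ medMap A B C D = (coprodInl A C ⊠ₕ coprodInl B D) :=
  prod_ext (by simp [medMap]) (by simp [medMap])

lemma inr_medMap (A B C D : X) :
    coprodInr (A ⊠ B) (C ⊠ D) ≫ medMap A B C D = (coprodInr A C ⊠ₕ coprodInr B D) :=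
  prod_ext (by simp [medMap]) (by simp [medMap])

lemma medMap_natural {A A' B B' C C' D D' : X} (f : A ⟶ A') (g : B ⟶ B') (h : C ⟶ C')
    (k : D ⟶ D') : ((f ⊠ₕ g) ⊞ₕ (h ⊠ₕ k)) ≫ medMap A' B' C' D' =
      medMap A B C D ≫ ((f ⊞ₕ h) ⊠ₕ (g ⊞ₕ k)) := by
  apply coprod_ext <;> apply prod_ext <;> simp [medMap]

lemma medMap_tensor_assoc (A B C D E F : X) :
    medMap (A ⊠ B) C (D ⊠ E) F ≫ (medMap A B D E ▷⊠ (C ⊞ F)) ≫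
        (α⊠ (A ⊞ D) (B ⊞ E) (C ⊞ F)).hom =
      ((α⊠ A B C).hom ⊞ₕ (α⊠ D E F).hom) ≫ medMap A (B ⊠ C) D (E ⊠ F) ≫
        ((A ⊞ D) ◁⊠ medMap B C E F) := by
  apply coprod_ext <;> apply prod_ext <;> try apply prod_ext
  all_goals simp [medMap]

lemma medMap_par_assoc (A B C D E F : X) :
    (α⊞ (A ⊠ B) (C ⊠ D) (E ⊠ F)).inv ≫ (medMap A B C D ▷⊞ (E ⊠ F)) ≫
        medMap (A ⊞ C) (B ⊞ D) E F =
      ((A ⊠ B) ◁⊞ medMap C D E F) ≫ medMap A B (C ⊞ E) (D ⊞ F) ≫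
        ((α⊞ A C E).inv ⊠ₕ (α⊞ B D F).inv) := by
  apply prod_ext <;> apply coprod_ext <;> try apply coprod_ext
  all_goals simp [medMap]

lemma medMap_tensor_braiding (A B C D : X) :
    medMap A B C D ≫ (β⊠ (A ⊞ C) (B ⊞ D)).hom =
      ((β⊠ A B).hom ⊞ₕ (β⊠ C D).hom) ≫ medMap B A D C := by
  apply coprod_ext <;> apply prod_ext <;> simp [medMap]

lemma medMap_par_braiding (A B C D : X) :
    medMap A B C D ≫ ((β⊞ A C).hom ⊠ₕ (β⊞ B D).hom) =
      (β⊞ (A ⊠ B) (C ⊠ D)).hom ≫ medMap C D A B := by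
  apply coprod_ext <;> apply prod_ext <;> simp [medMap]

lemma tensorAssociator_hom_snd (A B C : X) :
    (α⊠ A B C).hom ≫ prodSnd A (B ⊠ C) = (prodSnd A B ▷⊠ C) := by
  simp

lemma tensorAssociator_inv_fst (A B C : X) :
    (α⊠ A B C).inv ≫ prodFst (A ⊠ B) C = (A ◁⊠ prodFst B C) := by
  simp

lemma inl_parAssociator_hom (A B C : X) :
    coprodInl (A ⊞ B) C ≫ (α⊞ A B C).hom = (A ◁⊞ coprodInl B C) := by
  simp

lemma inr_parAssociator_inv (A B C : X) :
    coprodInr A (B ⊞ C) ≫ (α⊞ A B C).inv = (coprodInr A B ▷⊞ C) := by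
  simp

lemma medMap_δR_tensor (A B C D Z : X) :
    (medMap A B C D ▷⊠ Z) ≫ (α⊠ (A ⊞ C) (B ⊞ D) Z).hom ≫ ((A ⊞ C) ◁⊠ δR B D Z) =
      δR (A ⊠ B) (C ⊠ D) Z ≫ ((A ⊠ B) ◁⊞ (α⊠ C D Z).hom) ≫ medMap A B C (D ⊠ Z) := by
  apply prod_ext
  · calc
      _ = prodFst ((A ⊠ B) ⊞ (C ⊠ D)) Z ≫ (prodFst A B ⊞ₕ prodFst C D) := by simp [medMap]
      _ = δR (A ⊠ B) (C ⊠ D) Z ≫ (prodFst A B ⊞ₕ (prodFst (C ⊠ D) Z ≫ prodFst C D)) := by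
        rw [← δR_fst, Category.assoc, @MonoidalCategory.whiskerLeft_comp_tensorHom]
      _ = _ := by
        simp only [Category.assoc, medMap_fst, MonoidalCategory.whiskerLeft_comp_tensorHom,
          tensorAssociator_hom, prodLift_fst]
  · calc
      _ = ((prodSnd A B ⊞ₕ prodSnd C D) ▷⊠ Z) ≫ δR B D Z := by
        rw [Category.assoc, Category.assoc, tensorLeft_eq, prodLift_snd,
          reassoc_of% tensorAssociator_hom_snd, ← @MonoidalCategory.comp_whiskerRight_assoc,
          medMap_snd]
      _ = δR (A ⊠ B) (C ⊠ D) Z ≫ (prodSnd A B ⊞ₕ (prodSnd C D ▷⊠ Z)) := by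
        simpa only [MonoidalCategory.tensorHom_id] using
          δR_natural (prodSnd A B) (prodSnd C D) (𝟙 Z)
      _ = _ := by
        simp only [Category.assoc, medMap_snd, MonoidalCategory.whiskerLeft_comp_tensorHom,
          tensorAssociator_hom_snd]

lemma medMap_δL_tensor (A B C D Z : X) :
    (Z ◁⊠ medMap A B C D) ≫ (α⊠ Z (A ⊞ C) (B ⊞ D)).inv ≫ (δL Z A C ▷⊠ (B ⊞ D)) =
      δL Z (A ⊠ B) (C ⊠ D) ≫ ((α⊠ Z A B).inv ▷⊞ (C ⊠ D)) ≫ medMap (Z ⊠ A) B C D := by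
  apply prod_ext
  · calc
      _ = (Z ◁⊠ (prodFst A B ⊞ₕ prodFst C D)) ≫ δL Z A C := by
        rw [Category.assoc, Category.assoc, tensorRight_eq, prodLift_fst,
          reassoc_of% tensorAssociator_inv_fst, ← @MonoidalCategory.whiskerLeft_comp_assoc,
          medMap_fst]
      _ = δL Z (A ⊠ B) (C ⊠ D) ≫ ((Z ◁⊠ prodFst A B) ⊞ₕ prodFst C D) := by
        simpa only [MonoidalCategory.id_tensorHom] using
          δL_natural (𝟙 Z) (prodFst A B) (prodFst C D)
      _ = _ := by
        simp only [Category.assoc, medMap_fst, MonoidalCategory.whiskerRight_comp_tensorHom,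
          tensorAssociator_inv_fst]
  · calc
      _ = prodSnd Z ((A ⊠ B) ⊞ (C ⊠ D)) ≫ (prodSnd A B ⊞ₕ prodSnd C D) := by simp [medMap]
      _ = δL Z (A ⊠ B) (C ⊠ D) ≫ ((prodSnd Z (A ⊠ B) ≫ prodSnd A B) ⊞ₕ prodSnd C D) := by
        rw [← δL_snd, Category.assoc, @MonoidalCategory.whiskerRight_comp_tensorHom]
      _ = _ := by
        simp only [Category.assoc, medMap_snd, MonoidalCategory.whiskerRight_comp_tensorHom,
          tensorAssociator_inv, prodLift_snd]

lemma medMap_δR_par (A B C D Z : X) :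
    (δR Z A B ▷⊞ (C ⊠ D)) ≫ (α⊞ Z (A ⊠ B) (C ⊠ D)).hom ≫ (Z ◁⊞ medMap A B C D) =
      medMap (Z ⊞ A) B C D ≫ ((α⊞ Z A C).hom ▷⊠ (B ⊞ D)) ≫ δR Z (A ⊞ C) (B ⊞ D) := by
  apply coprod_ext
  · calc
      _ = δR Z A B ≫ (Z ◁⊞ (coprodInl A C ⊠ₕ coprodInl B D)) := by
        rw [parRight_eq, inl_coprodDesc_assoc, Category.assoc, reassoc_of% inl_parAssociator_hom,
          ← @MonoidalCategory.whiskerLeft_comp, inl_medMap]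
      _ = ((Z ◁⊞ coprodInl A C) ⊠ₕ coprodInl B D) ≫ δR Z (A ⊞ C) (B ⊞ D) := by
        simpa only [MonoidalCategory.id_tensorHom] using
          (δR_natural (𝟙 Z) (coprodInl A C) (coprodInl B D)).symm
      _ = _ := by
        rw [reassoc_of% inl_medMap, @MonoidalCategory.tensorHom_comp_whiskerRight_assoc,
          inl_parAssociator_hom]
  · calc
      _ = (coprodInr A C ⊠ₕ coprodInr B D) ≫ coprodInr Z ((A ⊞ C) ⊠ (B ⊞ D)) := by
        simp [reassoc_of% inr_medMap]
      _ = ((coprodInr A C ≫ coprodInr Z (A ⊞ C)) ⊠ₕ coprodInr B D) ≫ δR Z (A ⊞ C) (B ⊞ D) := by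
        rw [← inr_δR, @MonoidalCategory.tensorHom_comp_whiskerRight_assoc]
      _ = _ := by
        rw [reassoc_of% inr_medMap, @MonoidalCategory.tensorHom_comp_whiskerRight_assoc,
          parAssociator_hom, inr_coprodDesc]

lemma medMap_δL_par (A B C D Z : X) :
    ((A ⊠ B) ◁⊞ δL C D Z) ≫ (α⊞ (A ⊠ B) (C ⊠ D) Z).inv ≫ (medMap A B C D ▷⊞ Z) =
      medMap A B C (D ⊞ Z) ≫ ((A ⊞ C) ◁⊠ (α⊞ B D Z).inv) ≫ δL (A ⊞ C) (B ⊞ D) Z := by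
  apply coprod_ext
  · calc
      _ = (coprodInl A C ⊠ₕ coprodInl B D) ≫ coprodInl ((A ⊞ C) ⊠ (B ⊞ D)) Z := by
        simp [reassoc_of% inl_medMap]
      _ = (coprodInl A C ⊠ₕ (coprodInl B D ≫ coprodInl (B ⊞ D) Z)) ≫ δL (A ⊞ C) (B ⊞ D) Z := by
        rw [← inl_δL, @MonoidalCategory.tensorHom_comp_whiskerLeft_assoc]
      _ = _ := by
        rw [reassoc_of% inl_medMap, @MonoidalCategory.tensorHom_comp_whiskerLeft_assoc,
          parAssociator_inv, inl_coprodDesc]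
  · calc
      _ = δL C D Z ≫ ((coprodInr A C ⊠ₕ coprodInr B D) ▷⊞ Z) := by
        rw [parLeft_eq, inr_coprodDesc_assoc, Category.assoc, reassoc_of% inr_parAssociator_inv,
          ← @MonoidalCategory.comp_whiskerRight, inr_medMap]
      _ = (coprodInr A C ⊠ₕ (coprodInr B D ▷⊞ Z)) ≫ δL (A ⊞ C) (B ⊞ D) Z := by
        simpa only [MonoidalCategory.tensorHom_id] using
          (δL_natural (coprodInr A C) (coprodInr B D) (𝟙 Z)).symm
      _ = _ := by
        rw [reassoc_of% inr_medMap, @MonoidalCategory.tensorHom_comp_whiskerLeft_assoc,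
          inr_parAssociator_inv]

variable (X) in
/-- The canonical medial structure of a cartesian linearly distributive category. -/
@[reducible]
def canonicalMedial : MedialStructure X where
  Δbot := fromBot (⊥ₗ ⊠ ⊥ₗ)
  nablaTop := toTop (⊤ₗ ⊞ ⊤ₗ : X)
  mix := toTop ⊥ₗ
  med := medMap
  med_natural := medMap_natural
  mix_law := toTop_mix_law
  med_δR_tensor := medMap_δR_tensor
  med_δL_tensor := medMap_δL_tensor
  med_δR_par := medMap_δR_par
  med_δL_par := medMap_δL_par
  Δbot_assoc := fromBot_ext _ _
  Δbot_mix_right := fromBot_ext _ _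
  Δbot_mix_left := fromBot_ext _ _
  Δbot_comm := fromBot_ext _ _
  nablaTop_assoc := toTop_ext _ _
  mix_right_nablaTop := toTop_ext _ _
  mix_left_nablaTop := toTop_ext _ _
  nablaTop_comm := toTop_ext _ _
  med_tensor_assoc := medMap_tensor_assoc
  med_par_assoc := medMap_par_assoc
  Δbot_med_left A B :=
    coprod_ext (fromBot_ext _ _) (prod_ext (by simp [medMap]) (by simp [medMap]))
  Δbot_med_right A B :=
    coprod_ext (prod_ext (by simp [medMap]) (by simp [medMap])) (fromBot_ext _ _)
  med_nablaTop_left A B :=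
    prod_ext (toTop_ext _ _) (coprod_ext (by simp [medMap]) (by simp [medMap]))
  med_nablaTop_right A B :=
    prod_ext (coprod_ext (by simp [medMap]) (by simp [medMap])) (toTop_ext _ _)
  med_tensor_braiding := medMap_tensor_braiding
  med_par_braiding := medMap_par_braiding

variable (X) in
lemma canonicalMedial_isCanonical : IsCanonicalMedialStructure (canonicalMedial X) where
  Δbot_eq := rfl
  Δbot_fst := fromBot_ext _ _
  Δbot_snd := fromBot_ext _ _
  nablaTop_eq := rfl
  inl_nablaTop := toTop_ext _ _
  inr_nablaTop := toTop_ext _ _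
  mix_eq_toTop := rfl
  mix_eq_fromBot := fromBot_ext _ _
  med_fst := medMap_fst
  med_snd := medMap_snd
  inl_med := inl_medMap
  inr_med := inr_medMap

end Medial

/-! ## Cartesian linear functors -/

section LinearFunctors

variable {X : Type u₁} [Category.{v₁} X] {Y : Type u₂} [Category.{v₂} Y]

namespace LinearFunctorData

variable [TwoMonoidal X] [SymmLinDistCategory Y] [CartesianStructure Y]
  (F : LinearFunctorData X Y)

lemma hom_T_top_ext [IsIso F.mTop] {A : Y} (f g : A ⟶ F.T.obj ⊤ₗ) : f = g := by
  rw [← cancel_mono (inv F.mTop)]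
  exact toTop_ext _ _

lemma hom_P_bot_ext [IsIso F.nBot] {A : Y} (f g : F.P.obj ⊥ₗ ⟶ A) : f = g := by
  rw [← cancel_epi (inv F.nBot)]
  exact fromBot_ext _ _

end LinearFunctorData

namespace LinearFunctor

variable [LinDistCategory X] [LinDistCategory Y] (F : LinearFunctor X Y)

lemma νRT_bot (B : X) :
    F.T.map (λ⊞ B).inv ≫ F.νRT ⊥ₗ B ≫ (F.nBot ▷⊞ F.T.obj B) = (λ⊞ (F.T.obj B)).inv := by
  rw [← cancel_mono (λ⊞ (F.T.obj B)).hom, Iso.inv_hom_id, Category.assoc, Category.assoc,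
    F.νRT_unit, ← F.T.map_comp, Iso.inv_hom_id, F.T.map_id]

lemma νRP_top (B : X) :
    (F.mTop ▷⊠ F.P.obj B) ≫ F.νRP ⊤ₗ B ≫ F.P.map (λ⊠ B).hom = (λ⊠ (F.P.obj B)).hom := by
  rw [← cancel_epi (λ⊠ (F.P.obj B)).inv, Iso.inv_hom_id, reassoc_of% F.νRP_unit,
    ← F.P.map_comp, Iso.inv_hom_id, F.P.map_id]

end LinearFunctor

end LinearFunctors

section Functors

variable {X : Type u₁} [Category.{v₁} X] [SymmLinDistCategory X] [CartesianStructure X]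
  {Y : Type u₂} [Category.{v₂} Y] [SymmLinDistCategory Y] [CartesianStructure Y]

lemma inl_μ {T : X ⥤ Y} (M : ParLax T) (A B : X) :
    coprodInl (T.obj A) (T.obj B) ≫
        @Functor.LaxMonoidal.μ X _ TwoMonoidal.par Y _ TwoMonoidal.par T M A B =
      T.map (coprodInl A B) := by
  rw [coprodInl, coprodInl, fromBot_ext (fromBot (T.obj B)) (@Functor.LaxMonoidal.ε X _
      TwoMonoidal.par Y _ TwoMonoidal.par T M ≫ T.map (fromBot B)),
    @MonoidalCategory.whiskerLeft_comp, Category.assoc, Category.assoc,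
    @Functor.LaxMonoidal.μ_natural_right,
    @Functor.LaxMonoidal.right_unitality_inv_assoc _ _ TwoMonoidal.par, T.map_comp]

lemma inr_μ {T : X ⥤ Y} (M : ParLax T) (A B : X) :
    coprodInr (T.obj A) (T.obj B) ≫
        @Functor.LaxMonoidal.μ X _ TwoMonoidal.par Y _ TwoMonoidal.par T M A B =
      T.map (coprodInr A B) := by
  rw [coprodInr, coprodInr, fromBot_ext (fromBot (T.obj A)) (@Functor.LaxMonoidal.ε X _
      TwoMonoidal.par Y _ TwoMonoidal.par T M ≫ T.map (fromBot A)),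
    @MonoidalCategory.comp_whiskerRight, Category.assoc, Category.assoc,
    @Functor.LaxMonoidal.μ_natural_left,
    @Functor.LaxMonoidal.left_unitality_inv_assoc _ _ TwoMonoidal.par, T.map_comp]

instance subsingleton_parLax (T : X ⥤ Y) : Subsingleton (ParLax T) where
  allEq M N :=
    @Functor.LaxMonoidal.ext X _ TwoMonoidal.par Y _ TwoMonoidal.par T M N (fromBot_ext _ _) <|
      funext₂ fun A B =>
        coprod_ext ((inl_μ M A B).trans (inl_μ N A B).symm)
          ((inr_μ M A B).trans (inr_μ N A B).symm)

/-- The unique monoidal structure of a functor for the coproducts, with structure maps `b` and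
`[T ι₀, T ι₁]`. -/
@[reducible]
def canonicalParLax (T : X ⥤ Y) : ParLax T :=
  letI : MonoidalCategory X := TwoMonoidal.par
  letI : MonoidalCategory Y := TwoMonoidal.par
  { ε := fromBot (T.obj ⊥ₗ)
    μ A B := coprodDesc (T.map (coprodInl A B)) (T.map (coprodInr A B))
    μ_natural_left f B := by apply coprod_ext <;> simp [← Functor.map_comp]
    μ_natural_right A f := by apply coprod_ext <;> simp [← Functor.map_comp]
    associativity A B C := by
      apply coprod_ext <;> try apply coprod_ext
      all_goals simp [← Functor.map_comp]
    left_unitality A := coprod_ext (fromBot_ext _ _) (by simp [← Functor.map_comp])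
    right_unitality A := coprod_ext (by simp [← Functor.map_comp]) (fromBot_ext _ _) }

section Tensor

attribute [local instance] tensorCartesian

lemma δ_prodFst {P : X ⥤ Y} (M : TensorOplax P) (A B : X) :
    @Functor.OplaxMonoidal.δ X _ TwoMonoidal.tensor Y _ TwoMonoidal.tensor P M A B ≫
        prodFst (P.obj A) (P.obj B) =
      P.map (prodFst A B) :=
  let : P.OplaxMonoidal := M
  Functor.OplaxMonoidal.δ_fst P A B

lemma δ_prodSnd {P : X ⥤ Y} (M : TensorOplax P) (A B : X) :
    @Functor.OplaxMonoidal.δ X _ TwoMonoidal.tensor Y _ TwoMonoidal.tensor P M A B ≫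
        prodSnd (P.obj A) (P.obj B) =
      P.map (prodSnd A B) :=
  let : P.OplaxMonoidal := M
  Functor.OplaxMonoidal.δ_snd P A B

instance subsingleton_tensorOplax (P : X ⥤ Y) : Subsingleton (TensorOplax P) :=
  inferInstanceAs (Subsingleton P.OplaxMonoidal)

/-- The unique comonoidal structure of a functor for the products, with structure maps `t` and
`⟨P π₀, P π₁⟩`. -/
@[reducible]
def canonicalTensorOplax (P : X ⥤ Y) : TensorOplax P :=
  Functor.OplaxMonoidal.ofChosenFiniteProducts P

end Tensor

namespace LinearFunctorData

variable (F : LinearFunctorData X Y)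

section

variable [IsIso F.mTop]

lemma toTop_eq_map_inv_mTop (A : X) : toTop (F.T.obj A) = F.T.map (toTop A) ≫ inv F.mTop :=
  toTop_ext _ _

lemma mTen_fst (A B : X) :
    F.mTen A B ≫ F.T.map (prodFst A B) = prodFst (F.T.obj A) (F.T.obj B) := by
  have h := @Functor.LaxMonoidal.right_unitality X _ TwoMonoidal.tensor Y _ TwoMonoidal.tensor
    F.T F.lax A
  rw [prodFst, prodFst, F.T.map_comp, ← reassoc_of% F.mTen_natural_right, toTop_eq_map_inv_mTop, h,
    ← @MonoidalCategory.whiskerLeft_comp_assoc, Category.assoc, IsIso.inv_hom_id, Category.comp_id]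

lemma mTen_snd (A B : X) :
    F.mTen A B ≫ F.T.map (prodSnd A B) = prodSnd (F.T.obj A) (F.T.obj B) := by
  have h := @Functor.LaxMonoidal.left_unitality X _ TwoMonoidal.tensor Y _ TwoMonoidal.tensor
    F.T F.lax B
  rw [prodSnd, prodSnd, F.T.map_comp, ← reassoc_of% F.mTen_natural_left, toTop_eq_map_inv_mTop, h,
    ← @MonoidalCategory.comp_whiskerRight_assoc, Category.assoc, IsIso.inv_hom_id, Category.comp_id]

end

section

variable [IsIso F.nBot]

lemma fromBot_eq_inv_nBot_map (A : X) : fromBot (F.P.obj A) = inv F.nBot ≫ F.P.map (fromBot A) :=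
  fromBot_ext _ _

lemma inl_nPar (A B : X) :
    F.P.map (coprodInl A B) ≫ F.nPar A B = coprodInl (F.P.obj A) (F.P.obj B) := by
  have h := @Functor.OplaxMonoidal.oplax_right_unitality X _ TwoMonoidal.par Y _ TwoMonoidal.par
    F.P F.oplax A
  rw [coprodInl, coprodInl, F.P.map_comp, Category.assoc, ← F.nPar_natural_right,
    fromBot_eq_inv_nBot_map, h, Category.assoc, Category.assoc,
    ← @MonoidalCategory.whiskerLeft_comp, IsIso.hom_inv_id_assoc]

lemma inr_nPar (A B : X) :
    F.P.map (coprodInr A B) ≫ F.nPar A B = coprodInr (F.P.obj A) (F.P.obj B) := by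
  have h := @Functor.OplaxMonoidal.oplax_left_unitality X _ TwoMonoidal.par Y _ TwoMonoidal.par
    F.P F.oplax B
  rw [coprodInr, coprodInr, F.P.map_comp, Category.assoc, ← F.nPar_natural_left,
    fromBot_eq_inv_nBot_map, h, Category.assoc, Category.assoc,
    ← @MonoidalCategory.comp_whiskerRight, IsIso.hom_inv_id_assoc]

end

end LinearFunctorData

namespace LinearFunctor

variable (F : LinearFunctor X Y)

lemma inr_νRT [IsIso F.nBot] (A B : X) :
    F.T.map (coprodInr A B) ≫ F.νRT A B = coprodInr (F.P.obj A) (F.T.obj B) := by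
  rw [coprodInr, coprodInr, F.T.map_comp, Category.assoc, ← F.νRT_natural_left,
    F.fromBot_eq_inv_nBot_map, ← F.νRT_bot, Category.assoc, Category.assoc,
    ← @MonoidalCategory.comp_whiskerRight, IsIso.hom_inv_id_assoc]

lemma νRP_snd [IsIso F.mTop] (A B : X) :
    F.νRP A B ≫ F.P.map (prodSnd A B) = prodSnd (F.T.obj A) (F.P.obj B) := by
  rw [prodSnd, prodSnd, F.P.map_comp, ← reassoc_of% F.νRP_natural_left,
    F.toTop_eq_map_inv_mTop, ← F.νRP_top, ← @MonoidalCategory.comp_whiskerRight_assoc,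
    Category.assoc, IsIso.inv_hom_id, Category.comp_id]

end LinearFunctor

namespace StrongSymmLinearFunctor

variable (F : StrongSymmLinearFunctor X Y)

lemma inv_mTen_fst (A B : X) :
    inv (F.mTen A B) ≫ prodFst (F.T.obj A) (F.T.obj B) = F.T.map (prodFst A B) := by
  rw [IsIso.inv_comp_eq, F.mTen_fst]

lemma inv_mTen_snd (A B : X) :
    inv (F.mTen A B) ≫ prodSnd (F.T.obj A) (F.T.obj B) = F.T.map (prodSnd A B) := by
  rw [IsIso.inv_comp_eq, F.mTen_snd]

lemma inl_inv_nPar (A B : X) :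
    coprodInl (F.P.obj A) (F.P.obj B) ≫ inv (F.nPar A B) = F.P.map (coprodInl A B) := by
  rw [IsIso.comp_inv_eq, F.inl_nPar]

lemma inr_inv_nPar (A B : X) :
    coprodInr (F.P.obj A) (F.P.obj B) ≫ inv (F.nPar A B) = F.P.map (coprodInr A B) := by
  rw [IsIso.comp_inv_eq, F.inr_nPar]

end StrongSymmLinearFunctor

namespace MedialFunctorData

variable {F G : StrongSymmLinearFunctor X Y} (M : MedialFunctorData F) (N : MedialFunctorData G)

lemma inl_mPar (A B : X) :
    coprodInl (F.T.obj A) (F.T.obj B) ≫ M.mPar A B = F.T.map (coprodInl A B) :=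
  inl_μ M.parLax A B

lemma inr_mPar (A B : X) :
    coprodInr (F.T.obj A) (F.T.obj B) ≫ M.mPar A B = F.T.map (coprodInr A B) :=
  inr_μ M.parLax A B

lemma nTen_fst (A B : X) :
    M.nTen A B ≫ prodFst (F.P.obj A) (F.P.obj B) = F.P.map (prodFst A B) :=
  δ_prodFst M.tenOplax A B

lemma nTen_snd (A B : X) :
    M.nTen A B ≫ prodSnd (F.P.obj A) (F.P.obj B) = F.P.map (prodSnd A B) :=
  δ_prodSnd M.tenOplax A B

lemma isCanonical : IsCanonicalMedialFunctor M where
  mBot_eq := fromBot_ext _ _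
  inl_mPar := M.inl_mPar
  inr_mPar := M.inr_mPar
  nTop_eq := toTop_ext _ _
  nTen_fst := M.nTen_fst
  nTen_snd := M.nTen_snd

instance : Subsingleton (MedialFunctorData F) where
  allEq := fun ⟨_, _⟩ ⟨_, _⟩ => congr_arg₂ mk (Subsingleton.elim _ _) (Subsingleton.elim _ _)

lemma mPar_braiding (A B : X) :
    M.mPar A B ≫ F.T.map (β⊞ A B).hom = (β⊞ (F.T.obj A) (F.T.obj B)).hom ≫ M.mPar B A := by
  apply coprod_ext
  · rw [reassoc_of% M.inl_mPar, ← F.T.map_comp, parBraiding_hom, parBraiding_hom,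
      inl_coprodDesc, inl_coprodDesc_assoc, M.inr_mPar]
  · rw [reassoc_of% M.inr_mPar, ← F.T.map_comp, parBraiding_hom, parBraiding_hom,
      inr_coprodDesc, inr_coprodDesc_assoc, M.inl_mPar]

lemma nTen_braiding (A B : X) :
    M.nTen A B ≫ (β⊠ (F.P.obj A) (F.P.obj B)).hom = F.P.map (β⊠ A B).hom ≫ M.nTen B A := by
  apply prod_ext
  · rw [Category.assoc, Category.assoc, M.nTen_fst, ← F.P.map_comp, tensorBraiding_hom,
      tensorBraiding_hom, prodLift_fst, prodLift_fst, M.nTen_snd]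
  · rw [Category.assoc, Category.assoc, M.nTen_snd, ← F.P.map_comp, tensorBraiding_hom,
      tensorBraiding_hom, prodLift_snd, prodLift_snd, M.nTen_fst]

lemma T_medMap (A B C D : X) :
    (F.mTen A B ⊞ₕ F.mTen C D) ≫ M.mPar (A ⊠ B) (C ⊠ D) ≫ F.T.map (medMap A B C D) =
      medMap (F.T.obj A) (F.T.obj B) (F.T.obj C) (F.T.obj D) ≫ (M.mPar A C ⊠ₕ M.mPar B D) ≫
        F.mTen (A ⊞ C) (B ⊞ D) := by
  apply coprod_ext
  · rw [parHom_eq, inl_coprodDesc_assoc, Category.assoc, reassoc_of% M.inl_mPar,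
      ← F.T.map_comp, inl_medMap, reassoc_of% inl_medMap, ← F.mTen_natural,
      @MonoidalCategory.tensorHom_comp_tensorHom_assoc, M.inl_mPar, M.inl_mPar]
  · rw [parHom_eq, inr_coprodDesc_assoc, Category.assoc, reassoc_of% M.inr_mPar,
      ← F.T.map_comp, inr_medMap, reassoc_of% inr_medMap, ← F.mTen_natural,
      @MonoidalCategory.tensorHom_comp_tensorHom_assoc, M.inr_mPar, M.inr_mPar]

lemma P_medMap (A B C D : X) :
    F.P.map (medMap A B C D) ≫ M.nTen (A ⊞ C) (B ⊞ D) ≫ (F.nPar A C ⊠ₕ F.nPar B D) =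
      F.nPar (A ⊠ B) (C ⊠ D) ≫ (M.nTen A B ⊞ₕ M.nTen C D) ≫
        medMap (F.P.obj A) (F.P.obj B) (F.P.obj C) (F.P.obj D) := by
  apply prod_ext
  · simp only [Category.assoc, medMap_fst]
    rw [tensorHom_eq, prodLift_fst, reassoc_of% M.nTen_fst, ← F.P.map_comp_assoc, medMap_fst,
      ← F.nPar_natural, @MonoidalCategory.tensorHom_comp_tensorHom, M.nTen_fst, M.nTen_fst]
  · simp only [Category.assoc, medMap_snd]
    rw [tensorHom_eq, prodLift_snd, reassoc_of% M.nTen_snd, ← F.P.map_comp_assoc, medMap_snd,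
      ← F.nPar_natural, @MonoidalCategory.tensorHom_comp_tensorHom, M.nTen_snd, M.nTen_snd]

lemma νRT_medMap (A B C D : X) :
    F.T.map (medMap A B C D) ≫ inv (F.mTen (A ⊞ C) (B ⊞ D)) ≫ (F.νRT A C ⊠ₕ F.νRT B D) =
      F.νRT (A ⊠ B) (C ⊠ D) ≫ (M.nTen A B ⊞ₕ inv (F.mTen C D)) ≫
        medMap (F.P.obj A) (F.P.obj B) (F.T.obj C) (F.T.obj D) := by
  apply prod_ext
  · simp only [Category.assoc, medMap_fst]
    rw [tensorHom_eq, prodLift_fst, reassoc_of% F.inv_mTen_fst, ← F.T.map_comp_assoc, medMap_fst,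
      @MonoidalCategory.tensorHom_comp_tensorHom, M.nTen_fst, F.inv_mTen_fst, F.νRT_natural]
  · simp only [Category.assoc, medMap_snd]
    rw [tensorHom_eq, prodLift_snd, reassoc_of% F.inv_mTen_snd, ← F.T.map_comp_assoc, medMap_snd,
      @MonoidalCategory.tensorHom_comp_tensorHom, M.nTen_snd, F.inv_mTen_snd, F.νRT_natural]

lemma νRP_medMap (A B C D : X) :
    (F.νRP A B ⊞ₕ F.νRP C D) ≫ inv (F.nPar (A ⊠ B) (C ⊠ D)) ≫ F.P.map (medMap A B C D) =
      medMap (F.T.obj A) (F.P.obj B) (F.T.obj C) (F.P.obj D) ≫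
        (M.mPar A C ⊠ₕ inv (F.nPar B D)) ≫ F.νRP (A ⊞ C) (B ⊞ D) := by
  apply coprod_ext
  · rw [parHom_eq, inl_coprodDesc_assoc, Category.assoc, reassoc_of% F.inl_inv_nPar,
      ← F.P.map_comp, inl_medMap, reassoc_of% inl_medMap, ← F.νRP_natural,
      @MonoidalCategory.tensorHom_comp_tensorHom_assoc, M.inl_mPar, F.inl_inv_nPar]
  · rw [parHom_eq, inr_coprodDesc_assoc, Category.assoc, reassoc_of% F.inr_inv_nPar,
      ← F.P.map_comp, inr_medMap, reassoc_of% inr_medMap, ← F.νRP_natural,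
      @MonoidalCategory.tensorHom_comp_tensorHom_assoc, M.inr_mPar, F.inr_inv_nPar]

lemma mPar_νRT (A B C : X) :
    M.mPar (A ⊞ B) C ≫ F.T.map (α⊞ A B C).hom ≫ F.νRT A (B ⊞ C) =
      (F.νRT A B ▷⊞ F.T.obj C) ≫ (α⊞ (F.P.obj A) (F.T.obj B) (F.T.obj C)).hom ≫
        (F.P.obj A ◁⊞ M.mPar B C) := by
  apply coprod_ext
  · rw [reassoc_of% M.inl_mPar, ← F.T.map_comp_assoc, inl_parAssociator_hom,
      ← F.νRT_natural_right, parRight_eq, inl_coprodDesc_assoc, Category.assoc,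
      reassoc_of% inl_parAssociator_hom, ← @MonoidalCategory.whiskerLeft_comp, M.inl_mPar]
  · rw [reassoc_of% M.inr_mPar, ← F.T.map_comp_assoc, parAssociator_hom, inr_coprodDesc,
      F.T.map_comp, Category.assoc, F.inr_νRT, parRight_eq, inr_coprodDesc_assoc,
      parAssociator_hom, inr_coprodDesc_assoc, Category.assoc, parLeft_eq, inr_coprodDesc,
      reassoc_of% M.inr_mPar]

lemma νRP_nTen (A B C : X) :
    F.νRP A (B ⊠ C) ≫ F.P.map (α⊠ A B C).inv ≫ M.nTen (A ⊠ B) C =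
      (F.T.obj A ◁⊠ M.nTen B C) ≫ (α⊠ (F.T.obj A) (F.P.obj B) (F.P.obj C)).inv ≫
        (F.νRP A B ▷⊠ F.P.obj C) := by
  apply prod_ext <;> simp only [Category.assoc]
  · rw [M.nTen_fst, ← F.P.map_comp, tensorAssociator_inv_fst, ← F.νRP_natural_right,
      tensorRight_eq, prodLift_fst, reassoc_of% tensorAssociator_inv_fst,
      ← @MonoidalCategory.whiskerLeft_comp_assoc, M.nTen_fst]
  · rw [M.nTen_snd, ← F.P.map_comp, tensorAssociator_inv, prodLift_snd, F.P.map_comp,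
      reassoc_of% F.νRP_snd, tensorRight_eq, prodLift_snd, tensorAssociator_inv, prodLift_snd,
      tensorLeft_eq, prodLift_snd_assoc, Category.assoc, M.nTen_snd]

lemma isMedialTransformation (α : LinearTransformation F.toLinearFunctor G.toLinearFunctor) :
    IsMedialTransformation M N α where
  t_mBot := fromBot_ext _ _
  t_mPar A B := by
    apply coprod_ext
    · rw [reassoc_of% M.inl_mPar, parHom_eq, inl_coprodDesc_assoc, Category.assoc, N.inl_mPar,
        α.t.naturality]
    · rw [reassoc_of% M.inr_mPar, parHom_eq, inr_coprodDesc_assoc, Category.assoc, N.inr_mPar,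
        α.t.naturality]
  p_nTop := toTop_ext _ _
  p_nTen A B := by
    apply prod_ext <;> simp only [Category.assoc, tensorHom_eq, prodLift_fst, prodLift_snd]
    · rw [M.nTen_fst, reassoc_of% N.nTen_fst, α.p.naturality]
    · rw [M.nTen_snd, reassoc_of% N.nTen_snd, α.p.naturality]

end MedialFunctorData

instance MedialFunctorStructure.subsingleton [MedialStructure X] [MedialStructure Y]
    (F : StrongSymmLinearFunctor X Y) : Subsingleton (MedialFunctorStructure F) where
  allEq M N := by
    cases M
    cases N
    congr 1
    exact Subsingleton.elim _ _

lemma MedialLinearFunctor.toStrongSymmLinearFunctor_injective [MedialStructure X]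
    [MedialStructure Y] :
    Function.Injective (toStrongSymmLinearFunctor : MedialLinearFunctor X Y → _) := by
  rintro ⟨F, _⟩ ⟨_, _⟩ rfl
  exact congrArg (mk F) (Subsingleton.elim _ _)

/-- The canonical strong symmetric medial linear structure of a cartesian linear functor. -/
@[reducible]
def canonicalMedialFunctor (F : StrongSymmLinearFunctor X Y) :
    @MedialFunctorStructure X _ Y _ _ _ (canonicalMedial X) (canonicalMedial Y) F :=
  letI := canonicalMedial X
  letI := canonicalMedial Y
  let M : MedialFunctorData F := ⟨canonicalParLax F.T, canonicalTensorOplax F.P⟩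
  { toMedialFunctorData := M
    mPar_braiding := M.mPar_braiding
    nTen_braiding := M.nTen_braiding
    T_Δbot := fromBot_ext _ _
    T_nablaTop := F.hom_T_top_ext _ _
    T_mix := fromBot_ext _ _
    T_med := M.T_medMap
    P_Δbot := F.hom_P_bot_ext _ _
    P_nablaTop := toTop_ext _ _
    P_mix := toTop_ext _ _
    P_med := M.P_medMap
    νRP_Δbot := F.hom_P_bot_ext _ _
    νRT_nablaTop := F.hom_T_top_ext _ _
    νRT_med := M.νRT_medMap
    νRP_med := M.νRP_medMap
    mPar_νRT := M.mPar_νRT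
    νRP_nTen := M.νRP_nTen }

end Functors

section Inclusion

/-- The inclusion of cartesian into symmetric medial linearly distributive categories as an
assignment on cells, with the canonical medial structures. -/
abbrev canonicalInclusionStruct : PrelaxFunctorStruct CLDC.{v, u} SMLDC.{v, u} :=
  inclusionStruct (fun X => canonicalMedial X.carrier) canonicalMedialFunctor
    (MedialFunctorData.isMedialTransformation _ _)

lemma canonicalInclusionStruct_map_id (X : CLDC.{v, u}) :
    canonicalInclusionStruct.map (𝟙 X) = 𝟙 (canonicalInclusionStruct.obj X) :=
  let := canonicalMedial X.carrier
  MedialLinearFunctor.toStrongSymmLinearFunctor_injective (X := X.carrier) (Y := X.carrier) rfl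

lemma canonicalInclusionStruct_map_comp {X Y Z : CLDC.{v, u}} (F : X ⟶ Y) (G : Y ⟶ Z) :
    canonicalInclusionStruct.map (F ≫ G) =
      canonicalInclusionStruct.map F ≫ canonicalInclusionStruct.map G :=
  let := canonicalMedial X.carrier
  let := canonicalMedial Z.carrier
  MedialLinearFunctor.toStrongSymmLinearFunctor_injective (X := X.carrier) (Y := Z.carrier) rfl

/-- The inclusion 2-functor from cartesian to symmetric medial linearly distributive categories. -/
def canonicalInclusion : StrictPseudofunctor CLDC.{v, u} SMLDC.{v, u} :=
  StrictPseudofunctor.mk''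
    { toPrelaxFunctorStruct := canonicalInclusionStruct
      map₂_id := fun _ => rfl
      map₂_comp := fun _ _ => rfl
      map_id := canonicalInclusionStruct_map_id
      map_comp := canonicalInclusionStruct_map_comp
      map₂_whisker_left := fun _ _ _ _ => SMLDC.eq_conj _ _ _ _ HEq.rfl HEq.rfl
      map₂_whisker_right := fun _ _ => SMLDC.eq_conj _ _ _ _ HEq.rfl HEq.rfl }

end Inclusion

end LinDist

theorem mainTheorem5 :
    ∃ (med : ∀ X : LinDist.CLDC.{v, u}, LinDist.MedialStructure X.carrier)
      (medF : ∀ {X Y : LinDist.CLDC.{v, u}} (F : X ⟶ Y),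
        @LinDist.MedialFunctorStructure X.carrier _ Y.carrier _ _ _ (med X) (med Y) F)
      (medT : ∀ {X Y : LinDist.CLDC.{v, u}} {F G : X ⟶ Y} (α : F ⟶ G),
        LinDist.IsMedialTransformation (medF F).toMedialFunctorData
          (medF G).toMedialFunctorData α),
      (∀ X, LinDist.IsCanonicalMedialStructure (med X)) ∧
      (∀ {X Y : LinDist.CLDC.{v, u}} (F : X ⟶ Y),
        LinDist.IsCanonicalMedialFunctor (medF F).toMedialFunctorData) ∧
      ∃ I : StrictPseudofunctor LinDist.CLDC.{v, u} LinDist.SMLDC.{v, u},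
        I.toPrelaxFunctorStruct = LinDist.inclusionStruct med medF medT :=
  ⟨fun X => LinDist.canonicalMedial X.carrier, LinDist.canonicalMedialFunctor,
    LinDist.MedialFunctorData.isMedialTransformation _ _,
    fun X => LinDist.canonicalMedial_isCanonical X.carrier,
    fun _ => LinDist.MedialFunctorData.isCanonical _, LinDist.canonicalInclusion, rfl⟩
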